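/- Theorem. Let $\alpha>0$, $\beta\ge 0$ and $\delta>0$. There are constants $c,c_0>0$, depending only on $\alpha,\beta,\delta$, such that the following holds for all $n,m\in\mathbb N$ with $m>c_0n$ and every fixed $x\in\mathbb R^n\setminus\{0\}$. Let $a_1,\dots,a_m$ be independent $\mathcal N(0,I_n)$ random vectors, $y_i=|a_i^Tx|^2$, $\hat y=\frac1m\sum_{i=1}^m y_i$, and $$Y=\frac1m\sum_{i=1}^m \tanh\Big(\frac{y_i}{\alpha\hat y}\Big)\,\mathbb 1(y_i>\beta\hat y)\,a_ia_i^T .$$ (i) With probability at least $1-e^{-cm}$, for every unit leading eigenvector $v$ of $Y$ (a maximizer of $v^TYv$ over the unit sphere), the estimate $z_0=\sqrt{\hat y}\,v$ satisfies $$\min\{\|z_0-x\|,\|z_0+x\|\}\le\delta\|x\|.$$ (ii) There is $T_0$, depending only on $\alpha,\beta,\delta,n,m$, such that for every $T\ge T_0$ the following holds. Let $g\sim\mathcal N(0,I_n)$ be independent of $(a_1,\dots,a_m)$, let $z^{0}=g/\|g\|$, $z^{t}=Yz^{t-1}/\|Yz^{t-1}\|$ for $1\le t\le T$, and $z_0=\sqrt{\hat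 y}\,z^{T}$. Then, with probability at least $1-e^{-cm}$, $$\min\{\|z_0-x\|,\|z_0+x\|\}\le\delta\|x\|.$$ -/

import Mathlib

open MeasureTheory ProbabilityTheory

noncomputable section

namespace TanhSpectral

/-- The intensity measurements `y_i = |a_iᵀ x|²`. -/
def intensity {n m : ℕ} (a : Fin m → EuclideanSpace ℝ (Fin n)) (x : EuclideanSpace ℝ (Fin n))
    (i : Fin m) : ℝ :=
  |inner ℝ (a i) x| ^ 2

/-- The sample mean `ŷ = (1/m) ∑ y_i`. -/
def sampleMean {m : ℕ} (y : Fin m → ℝ) : ℝ :=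
  (1 / (m : ℝ)) * ∑ i, y i

open Classical in
/-- The truncated tanh weight `tanh (y_i / (α ŷ)) · 𝟙 (y_i > β ŷ)`. -/
def weight (α β : ℝ) {m : ℕ} (y : Fin m → ℝ) (i : Fin m) : ℝ :=
  if y i > β * sampleMean y then Real.tanh (y i / (α * sampleMean y)) else 0

/-- The weighted sample covariance `∑ w_i a_i a_iᵀ`, applied to the vector `v`. -/
def weightedCov (α β : ℝ) {n m : ℕ} (a : Fin m → EuclideanSpace ℝ (Fin n)) (y : Fin m → ℝ)
    (v : EuclideanSpace ℝ (Fin n)) : EuclideanSpace ℝ (Fin n) :=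
  ∑ i, (weight α β y i * inner ℝ (a i) v) • a i

/-- The quadratic form `(1/m) ∑ w_i vᵀ a_i a_iᵀ v`. -/
def rayleigh (α β : ℝ) {n m : ℕ} (a : Fin m → EuclideanSpace ℝ (Fin n)) (y : Fin m → ℝ)
    (v : EuclideanSpace ℝ (Fin n)) : ℝ :=
  (1 / (m : ℝ)) * ∑ i, weight α β y i * inner ℝ (a i) v ^ 2

/-- `v` is a unit leading eigenvector of the weighted sample covariance: a maximizer of its
quadratic form on the unit sphere. -/
def IsLeadingEigenvector (α β : ℝ) {n m : ℕ} (a : Fin m → EuclideanSpace ℝ (Fin n))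
    (y : Fin m → ℝ) (v : EuclideanSpace ℝ (Fin n)) : Prop :=
  ‖v‖ = 1 ∧ ∀ u : EuclideanSpace ℝ (Fin n), ‖u‖ = 1 → rayleigh α β a y u ≤ rayleigh α β a y v

/-- The normalized power iteration for the weighted sample covariance, started at `g / ‖g‖`. -/
def powerIterate (α β : ℝ) {n m : ℕ} (a : Fin m → EuclideanSpace ℝ (Fin n)) (y : Fin m → ℝ)
    (g : EuclideanSpace ℝ (Fin n)) : ℕ → EuclideanSpace ℝ (Fin n)
  | 0 => ‖g‖⁻¹ • g
  | t + 1 =>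
    ‖weightedCov α β a y (powerIterate α β a y g t)‖⁻¹ •
      weightedCov α β a y (powerIterate α β a y g t)

/-- The initial estimate `z₀ = √ŷ · v` computed from a direction `v`. -/
def rescale {n m : ℕ} (y : Fin m → ℝ) (v : EuclideanSpace ℝ (Fin n)) :
    EuclideanSpace ℝ (Fin n) :=
  Real.sqrt (sampleMean y) • v

/-- The distance up to the global sign, `min (‖z - x‖) (‖z + x‖)`. -/
def signDist {n : ℕ} (z x : EuclideanSpace ℝ (Fin n)) : ℝ :=
  min ‖z - x‖ ‖z + x‖

end TanhSpectral

end

noncomputable section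

namespace TanhSpectral

section Profile

open Filter Topology

/-! ### The truncated `tanh` profile -/

/-! Write `x = ‖x‖ e`. Since the weight depends only on the ratio `y_i / ŷ`, the length of `x`
cancels from the quadratic form, which becomes the average of `f_s(⟨a_i, e⟩²) ⟨a_i, u⟩²`, where
`f_s` is `profile` at the random scale `s`, the average of the `⟨a_i, e⟩²`. At a fixed scale its
expectation on the unit sphere is `p_s + (r_s - p_s) ⟨u, e⟩²`, with `p_s = E f_s(ξ²)` and `r_s = E
f_s(ξ²) ξ²` for a standard Gaussian `ξ`. At `s = 1` the gap `r - p` is the covariance of `f_1(ξ²)`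
and `ξ²`, positive because `f_1` is nondecreasing (`profileMoment_gap`). So the mean form is largest
exactly at `±e`.

The random scale couples the summands. As `f_s` decreases in `s`, and `s` lies in `[1 - τ, 1 + τ]`
with high probability, the form is squeezed between forms at deterministic scales, which are
averages of independent variables dominated by squared Gaussians. Chernoff bounds at the points of a
net, a union bound and `norm_sq_le_of_net` then give the event `WellSpread` up to exponentially
small probability once `m` exceeds a multiple of `n` (`exists_rate_not_wellSpread`).

The rest is deterministic. On `WellSpread`, any unit vector with nearly maximal form is close to
`±e` (`WellSpread.signDist_le`), which settles leading eigenvectors. For power iteration, the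
operator is smaller by a factor `ρ < 1` on the complement of its leading eigenvector, so a start
with overlap at least `ε` converges at a rate independent of the sample
(`WellSpread.exists_direction`). A Gaussian start has such overlap except with probability half the
allowed failure (`exists_overlap`). -/

theorem tanh_strictMono : StrictMono Real.tanh := by
  intro x y hxy
  rw [Real.tanh_eq_sinh_div_cosh, Real.tanh_eq_sinh_div_cosh,
    div_lt_div_iff₀ (Real.cosh_pos x) (Real.cosh_pos y)]
  have h : 0 < Real.sinh (y - x) := Real.sinh_pos_iff.2 (sub_pos.2 hxy)
  rw [Real.sinh_sub] at h
  linarith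

theorem continuous_tanh : Continuous Real.tanh := by
  have : Real.tanh = fun x => Real.sinh x / Real.cosh x :=
    funext Real.tanh_eq_sinh_div_cosh
  rw [this]
  exact Real.continuous_sinh.div Real.continuous_cosh fun x => (Real.cosh_pos x).ne'

theorem tanh_nonneg {x : ℝ} (hx : 0 ≤ x) : 0 ≤ Real.tanh x := by
  simpa using tanh_strictMono.monotone hx

theorem tanh_pos {x : ℝ} (hx : 0 < x) : 0 < Real.tanh x := by
  simpa using tanh_strictMono hx

/-- The weight `tanh (y / (α s)) · 𝟙 (y > β s)` of an intensity `y` at scale `s`. -/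
def profile (α β s y : ℝ) : ℝ :=
  if β * s < y then Real.tanh (y / (α * s)) else 0

variable {α β : ℝ}

theorem weight_eq_profile {m : ℕ} (y : Fin m → ℝ) (i : Fin m) :
    weight α β y i = profile α β (sampleMean y) (y i) := by
  simp [weight, profile]

theorem profile_nonneg (hα : 0 < α) {s y : ℝ} (hs : 0 ≤ s) (hy : 0 ≤ y) :
    0 ≤ profile α β s y := by
  unfold profile
  split_ifs
  · exact tanh_nonneg (by positivity)
  · exact le_rfl

theorem profile_le_one (s y : ℝ) : profile α β s y ≤ 1 := by
  unfold profile
  split_ifs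
  · exact (Real.tanh_lt_one _).le
  · exact zero_le_one

theorem abs_profile_le_one (s y : ℝ) : |profile α β s y| ≤ 1 := by
  unfold profile
  split_ifs
  · exact (Real.abs_tanh_lt_one _).le
  · simp

/-- Raising the scale shrinks both the argument of `tanh` and the set where the indicator is 1. This
allows the random scale to be replaced by deterministic ones on either side. -/
theorem profile_antitone (hα : 0 < α) (hβ : 0 ≤ β) {s s' y : ℝ} (hs : 0 < s) (hss : s ≤ s')
    (hy : 0 ≤ y) : profile α β s' y ≤ profile α β s y := by
  unfold profile
  have h : β * s ≤ β * s' := by gcongr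
  split_ifs with h1 h2
  · apply tanh_strictMono.monotone
    gcongr
  · exact absurd (h.trans_lt h1) h2
  · exact tanh_nonneg (by positivity)
  · exact le_rfl

theorem profile_smul {l : ℝ} (hl : 0 < l) (s y : ℝ) :
    profile α β (l * s) (l * y) = profile α β s y := by
  unfold profile
  have h1 : (β * (l * s) < l * y) ↔ β * s < y := by
    rw [show β * (l * s) = l * (β * s) by ring]
    exact mul_lt_mul_iff_right₀ hl
  have h2 : l * y / (α * (l * s)) = y / (α * s) := by
    rw [show α * (l * s) = l * (α * s) by ring]
    exact mul_div_mul_left _ _ hl.ne'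
  simp only [h1, h2]

theorem measurable_profile_uncurry : Measurable fun q : ℝ × ℝ => profile α β q.1 q.2 := by
  unfold profile
  refine Measurable.ite (measurableSet_lt (by fun_prop) (by fun_prop)) ?_ measurable_const
  exact continuous_tanh.measurable.comp (by fun_prop)

theorem measurable_profile (s : ℝ) : Measurable (profile α β s) :=
  measurable_profile_uncurry.comp (measurable_const.prodMk measurable_id)

theorem profile_mono (hα : 0 < α) (hβ : 0 ≤ β) {s y y' : ℝ} (hs : 0 < s) (h : y ≤ y') :
    profile α β s y ≤ profile α β s y' := by
  unfold profile
  split_ifs with h1 h2 h2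
  · apply tanh_strictMono.monotone
    gcongr
  · exact absurd (h1.trans_le h) h2
  · have : 0 ≤ β * s := by positivity
    exact tanh_nonneg (by have := this.trans h2.le; positivity)
  · exact le_rfl

theorem profile_lt (hα : 0 < α) (hβ : 0 ≤ β) {s y y' : ℝ} (hs : 0 < s) (h : y < y')
    (h' : β * s < y') : profile α β s y < profile α β s y' := by
  unfold profile
  rw [if_pos h']
  split_ifs with h1
  · apply tanh_strictMono
    gcongr
  · have : 0 ≤ β * s := by positivity
    exact tanh_pos (by have := this.trans_lt h'; positivity)

/-- Near scale 1 the indicator is locally constant unless the intensity sits exactly at the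
threshold `β`. -/
theorem continuousAt_profile_scale (hα : 0 < α) {y : ℝ} (hy : y ≠ β) :
    ContinuousAt (fun s => profile α β s y) 1 := by
  have hlim : Tendsto (fun s : ℝ => β * s) (𝓝 1) (𝓝 β) := by
    have : ContinuousAt (fun s : ℝ => β * s) 1 := by fun_prop
    simpa [ContinuousAt] using this
  rcases lt_or_gt_of_ne hy with h | h
  · have : (fun s => profile α β s y) =ᶠ[𝓝 1] fun _ => 0 := by
      filter_upwards [hlim.eventually_const_lt h] with s hs
      simp [profile, not_lt.2 hs.le]
    exact continuousAt_const.congr this.symm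
  · have : (fun s => profile α β s y) =ᶠ[𝓝 1] fun s => Real.tanh (y / (α * s)) := by
      filter_upwards [hlim.eventually_lt_const h] with s hs
      simp [profile, hs]
    refine ContinuousAt.congr ?_ this.symm
    refine continuous_tanh.continuousAt.comp ?_
    exact continuousAt_const.div (by fun_prop) (by simpa using hα.ne')

/-! ### Moments of the profile under the standard Gaussian law -/

/-- `E f_s(ξ²) ξ^{2k}` for a standard Gaussian `ξ` and the profile `f_s`. -/
def profileMoment (α β s : ℝ) (k : ℕ) : ℝ :=
  ∫ z, profile α β s (z ^ 2) * (z ^ 2) ^ k ∂gaussianReal 0 1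

theorem integrable_sq_pow_gaussianReal (k : ℕ) :
    Integrable (fun z : ℝ => (z ^ 2) ^ k) (gaussianReal 0 1) := by
  have h := (memLp_id_gaussianReal (μ := 0) (v := 1) (2 * k : ℕ)).integrable_norm_pow'
  refine h.congr (ae_of_all _ fun z => ?_)
  simp [pow_mul]

theorem integral_sq_gaussianReal : ∫ z, z ^ 2 ∂gaussianReal 0 1 = 1 := by
  have h := variance_fun_id_gaussianReal (μ := 0) (v := 1)
  rw [variance_eq_integral (by fun_prop)] at h
  simpa [integral_id_gaussianReal] using h

theorem integrable_profile_mul (s : ℝ) (k : ℕ) :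
    Integrable (fun z : ℝ => profile α β s (z ^ 2) * (z ^ 2) ^ k) (gaussianReal 0 1) := by
  refine (integrable_sq_pow_gaussianReal k).mono' ?_ (ae_of_all _ fun z => ?_)
  · exact (((measurable_profile s).comp (by fun_prop)).mul (by fun_prop)).aestronglyMeasurable
  · rw [norm_mul, Real.norm_eq_abs, Real.norm_eq_abs, abs_of_nonneg (by positivity : 0 ≤ (z ^ 2) ^ k)]
    exact mul_le_of_le_one_left (by positivity) (abs_profile_le_one _ _)

theorem profileMoment_nonneg (hα : 0 < α) {s : ℝ} (hs : 0 ≤ s) (k : ℕ) :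
    0 ≤ profileMoment α β s k :=
  integral_nonneg fun z => mul_nonneg (profile_nonneg hα hs (by positivity)) (by positivity)

/-- Dominated convergence: the profile is discontinuous in the scale only at `z = ±√β`, a null set
because the Gaussian law has no atoms. -/
theorem continuousAt_profileMoment (hα : 0 < α) (k : ℕ) :
    ContinuousAt (fun s => profileMoment α β s k) 1 := by
  unfold profileMoment
  refine continuousAt_of_dominated (bound := fun z => (z ^ 2) ^ k)
    (Eventually.of_forall fun s => (integrable_profile_mul s k).aestronglyMeasurable)
    (Eventually.of_forall fun s => ae_of_all _ fun z => ?_) (integrable_sq_pow_gaussianReal k) ?_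
  · rw [norm_mul, Real.norm_eq_abs, Real.norm_eq_abs, abs_of_nonneg (by positivity : 0 ≤ (z ^ 2) ^ k)]
    exact mul_le_of_le_one_left (by positivity) (abs_profile_le_one _ _)
  · have hfin : ({Real.sqrt β, -Real.sqrt β} : Set ℝ).Finite := by simp
    have : NullSingletonClass (gaussianReal 0 1) := nullSingletonClass_gaussianReal one_ne_zero
    have h0 : ∀ᵐ z ∂gaussianReal 0 1, z ∉ ({Real.sqrt β, -Real.sqrt β} : Set ℝ) :=
      measure_eq_zero_iff_ae_notMem.1 (hfin.measure_zero _)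
    filter_upwards [h0] with z hz
    refine (continuousAt_profile_scale hα ?_).mul continuousAt_const
    rintro rfl
    rw [Real.sqrt_sq_eq_abs] at hz
    rcases abs_cases z with h | h <;> simp [h.1] at hz

/-- Since `E (ξ² - 1) = 0`, the constant `f 1` may be subtracted, and the gap becomes `E (f(ξ²) - f
1)(ξ² - 1)`. Both factors have the same sign because `f` is nondecreasing. -/
theorem profileMoment_gap (hα : 0 < α) (hβ : 0 ≤ β) :
    profileMoment α β 1 0 < profileMoment α β 1 1 := by
  set f : ℝ → ℝ := fun y => profile α β 1 y
  have i0 := integrable_profile_mul (α := α) (β := β) 1 0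
  have i1 := integrable_profile_mul (α := α) (β := β) 1 1
  have isq := integrable_sq_pow_gaussianReal 1
  simp only [pow_zero, mul_one, pow_one] at i0 i1 isq
  have i2 : Integrable (fun z : ℝ => f 1 * (z ^ 2 - 1)) (gaussianReal 0 1) :=
    (isq.sub (integrable_const 1)).const_mul _
  have key : profileMoment α β 1 1 - profileMoment α β 1 0
      = ∫ z, (f (z ^ 2) - f 1) * (z ^ 2 - 1) ∂gaussianReal 0 1 := by
    have h1 : ∫ z : ℝ, f 1 * (z ^ 2 - 1) ∂gaussianReal 0 1 = 0 := by
      rw [integral_const_mul, integral_sub isq (integrable_const 1), integral_sq_gaussianReal]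
      simp
    have h2 : ∀ z : ℝ, (f (z ^ 2) - f 1) * (z ^ 2 - 1)
        = f (z ^ 2) * z ^ 2 - f (z ^ 2) - f 1 * (z ^ 2 - 1) := fun z => by ring
    simp only [h2]
    have h3 := integral_sub (i1.sub i0) i2
    have h4 := integral_sub i1 i0
    simp only [Pi.sub_apply] at h3
    rw [h3, h1, h4]
    simp [profileMoment]
  have hpos : 0 < ∫ z, (f (z ^ 2) - f 1) * (z ^ 2 - 1) ∂gaussianReal 0 1 := by
    have hnn : ∀ z : ℝ, 0 ≤ (f (z ^ 2) - f 1) * (z ^ 2 - 1) := by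
      intro z
      rcases le_total (z ^ 2) 1 with h | h
      · exact mul_nonneg_of_nonpos_of_nonpos
          (sub_nonpos.2 (profile_mono hα hβ one_pos h)) (sub_nonpos.2 h)
      · exact mul_nonneg (sub_nonneg.2 (profile_mono hα hβ one_pos h)) (sub_nonneg.2 h)
    have hint : Integrable (fun z : ℝ => (f (z ^ 2) - f 1) * (z ^ 2 - 1)) (gaussianReal 0 1) := by
      refine ((i1.sub i0).sub i2).congr (ae_of_all _ fun z => ?_)
      simp only [Pi.sub_apply, f]
      ring
    rw [integral_pos_iff_support_of_nonneg hnn hint]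
    -- Beyond `1 + β` the square exceeds both 1 and the threshold `β`, where the profile increases
    -- strictly.
    have hsub : Set.Ioi (1 + β) ⊆ Function.support fun z : ℝ => (f (z ^ 2) - f 1) * (z ^ 2 - 1) := by
      intro z hz
      have hz : 1 + β < z := hz
      have h1 : 1 < z ^ 2 := by nlinarith
      have h2 : β * 1 < z ^ 2 := by nlinarith
      exact (mul_pos (sub_pos.2 (profile_lt hα hβ one_pos h1 h2)) (sub_pos.2 h1)).ne'
    refine lt_of_lt_of_le ?_ (measure_mono hsub)
    rw [pos_iff_ne_zero]
    intro h
    have := gaussianReal_absolutelyContinuous' 0 (v := 1) one_ne_zero h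
    simp at this
  linarith

end Profile

section Chernoff

/-! ### Chernoff bounds for variables dominated by a squared Gaussian -/

theorem exp_le_one_add_add_sq_mul_exp (x : ℝ) :
    Real.exp x ≤ 1 + x + x ^ 2 * Real.exp |x| := by
  have h := Complex.norm_exp_sub_sum_le_norm_mul_exp (x : ℂ) 2
  have h2 : Complex.exp (x : ℂ) - ∑ m ∈ Finset.range 2, (x : ℂ) ^ m / (m.factorial : ℂ)
      = ((Real.exp x - (1 + x) : ℝ) : ℂ) := by
    simp [Finset.sum_range_succ]
  rw [h2, Complex.norm_real, Complex.norm_real, Real.norm_eq_abs, Real.norm_eq_abs, sq_abs] at h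
  linarith [le_abs_self (Real.exp x - (1 + x))]

theorem integrable_exp_sq_gaussianReal :
    Integrable (fun z : ℝ => Real.exp (z ^ 2 / 4)) (gaussianReal 0 1) := by
  rw [gaussianReal_of_var_ne_zero _ one_ne_zero,
    integrable_withDensity_iff (measurable_gaussianPDF 0 1) (ae_of_all _ fun x => gaussianPDF_lt_top)]
  have h := (integrable_exp_neg_mul_sq (b := 1 / 4) (by norm_num)).const_mul
    ((Real.sqrt (2 * Real.pi * (1 : NNReal)))⁻¹)
  refine h.congr (ae_of_all _ fun x => ?_)
  simp only [toReal_gaussianPDF, gaussianPDFReal]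
  rw [mul_left_comm, ← Real.exp_add]
  congr 2
  simp
  ring

/-- The exponential moment of a squared standard Gaussian controlling the quadratic term
of the moment generating functions below. -/
def expSqMoment : ℝ := 128 * ∫ z, Real.exp (z ^ 2 / 4) ∂gaussianReal 0 1

theorem expSqMoment_pos : 0 < expSqMoment := by
  unfold expSqMoment
  have := integral_exp_pos integrable_exp_sq_gaussianReal
  positivity

variable {Ω : Type*} [MeasurableSpace Ω] {μ : Measure Ω}

/-- The polynomial factor costs one `exp (z² / 8)`, from `(z² / 8)² / 2 ≤ exp (z² / 8)`, and the
exponential factor costs another because `|t| ≤ 1/8`. Their product `exp (z² / 4)` is still Gaussian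
integrable. -/
theorem sq_mul_exp_abs_le {t x z : ℝ} (ht : |t| ≤ 1 / 8) (h0 : 0 ≤ x) (h1 : x ≤ z ^ 2) :
    (t * x) ^ 2 * Real.exp |t * x| ≤ t ^ 2 * (128 * Real.exp (z ^ 2 / 4)) := by
  have e1 : |t * x| ≤ z ^ 2 / 8 := by
    rw [abs_mul, abs_of_nonneg h0]
    nlinarith [abs_nonneg t]
  have e2 : x ^ 2 ≤ 128 * Real.exp (z ^ 2 / 8) := by
    have := Real.quadratic_le_exp_of_nonneg (x := z ^ 2 / 8) (by positivity)
    nlinarith [sq_nonneg z]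
  have e3 : Real.exp (z ^ 2 / 4) = Real.exp (z ^ 2 / 8) * Real.exp (z ^ 2 / 8) := by
    rw [← Real.exp_add]; ring_nf
  have e4 := Real.exp_le_exp.2 e1
  rw [mul_pow, mul_assoc, e3, ← mul_assoc 128]
  gcongr

theorem integrable_exp_mul_of_le_sq {X G : Ω → ℝ} (hG : HasLaw G (gaussianReal 0 1) μ)
    (hX : AEMeasurable X μ) (h0 : ∀ ω, 0 ≤ X ω) (h1 : ∀ ω, X ω ≤ G ω ^ 2) {t : ℝ}
    (ht : |t| ≤ 1 / 8) : Integrable (fun ω => Real.exp (t * X ω)) μ := by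
  have hI : Integrable (fun ω => Real.exp (G ω ^ 2 / 4)) μ := by
    have := integrable_exp_sq_gaussianReal
    rw [← hG.map_eq] at this
    exact this.comp_aemeasurable hG.aemeasurable
  refine hI.mono' (by fun_prop) (ae_of_all _ fun ω => ?_)
  rw [Real.norm_eq_abs, Real.abs_exp]
  apply Real.exp_le_exp.2
  have : t * X ω ≤ |t| * X ω := by gcongr; exacts [h0 ω, le_abs_self t]
  nlinarith [h0 ω, h1 ω, abs_nonneg t]

variable [IsProbabilityMeasure μ]

/-- Second-order expansion of the exponential, with the remainder dominated through `G`. The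
constant does not depend on `X`, so one deviation rate serves every direction and scale. -/
theorem mgf_le_of_le_sq {X G : Ω → ℝ} (hG : HasLaw G (gaussianReal 0 1) μ)
    (hX : AEMeasurable X μ) (h0 : ∀ ω, 0 ≤ X ω) (h1 : ∀ ω, X ω ≤ G ω ^ 2) {t : ℝ}
    (ht : |t| ≤ 1 / 8) : mgf X μ t ≤ Real.exp (t * μ[X] + expSqMoment * t ^ 2) := by
  have hI : Integrable (fun ω => Real.exp (G ω ^ 2 / 4)) μ := by
    have := integrable_exp_sq_gaussianReal
    rw [← hG.map_eq] at this
    exact this.comp_aemeasurable hG.aemeasurable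
  have hC : 128 * ∫ ω, Real.exp (G ω ^ 2 / 4) ∂μ = expSqMoment := by
    rw [expSqMoment, ← hG.map_eq, integral_map hG.aemeasurable (by fun_prop)]
  have hXI : Integrable X μ := by
    have hsq := integrable_sq_pow_gaussianReal 1
    rw [← hG.map_eq] at hsq
    refine (hsq.comp_aemeasurable hG.aemeasurable).mono' hX.aestronglyMeasurable
      (ae_of_all _ fun ω => ?_)
    simpa [abs_of_nonneg (h0 ω)] using h1 ω
  calc mgf X μ t ≤ ∫ ω, (1 + t * X ω + t ^ 2 * (128 * Real.exp (G ω ^ 2 / 4))) ∂μ := by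
        refine integral_mono (integrable_exp_mul_of_le_sq hG hX h0 h1 ht) ?_ fun ω => ?_
        · exact ((integrable_const _).add (hXI.const_mul _)).add ((hI.const_mul _).const_mul _)
        · exact (exp_le_one_add_add_sq_mul_exp _).trans
            (add_le_add le_rfl (sq_mul_exp_abs_le ht (h0 ω) (h1 ω)))
    _ = (t * μ[X] + expSqMoment * t ^ 2) + 1 := by
        have e1 := integral_add ((integrable_const (μ := μ) (1 : ℝ)).add (hXI.const_mul t))
          ((hI.const_mul 128).const_mul (t ^ 2))
        have e2 := integral_add (integrable_const (μ := μ) (1 : ℝ)) (hXI.const_mul t)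
        simp only [Pi.add_apply] at e1
        rw [e1, e2, integral_const_mul, integral_const_mul, integral_const_mul, hC]
        simp
        ring
    _ ≤ _ := Real.add_one_le_exp _

/-- The deviation rate at level `η` of averages of variables dominated by squared Gaussians. -/
def rate (η : ℝ) : ℝ := min (1 / 8) (η / (2 * expSqMoment)) * η / 2

theorem rate_pos {η : ℝ} (hη : 0 < η) : 0 < rate η := by
  have := expSqMoment_pos
  unfold rate
  positivity

/-- The choice `t ≤ η / (2 C)`, with `C` the constant `expSqMoment`, makes the quadratic cost `C t²`
at most half of the gain `t η`. -/
theorem rate_le {η : ℝ} (hη : 0 < η) :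
    let t := min (1 / 8) (η / (2 * expSqMoment))
    rate η ≤ t * η - expSqMoment * t ^ 2 := by
  intro t
  have hC := expSqMoment_pos
  have ht0 : 0 < t := by positivity
  have ht1 : t ≤ η / (2 * expSqMoment) := min_le_right _ _
  rw [le_div_iff₀ (by positivity)] at ht1
  change t * η / 2 ≤ _
  nlinarith

theorem measure_sum_ge_le {m : ℕ} {X G : Fin m → Ω → ℝ} {E η : ℝ} (hη : 0 < η)
    (hind : iIndepFun X μ) (hG : ∀ i, HasLaw (G i) (gaussianReal 0 1) μ)
    (hX : ∀ i, Measurable (X i)) (h0 : ∀ i ω, 0 ≤ X i ω) (h1 : ∀ i ω, X i ω ≤ G i ω ^ 2)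
    (hE : ∀ i, μ[X i] = E) :
    μ.real {ω | m * (E + η) ≤ ∑ i, X i ω} ≤ Real.exp (-(rate η * m)) := by
  set t := min (1 / 8) (η / (2 * expSqMoment)) with ht
  have hC := expSqMoment_pos
  have ht0 : 0 < t := by positivity
  have ht8 : |t| ≤ 1 / 8 := by rw [abs_of_pos ht0]; exact min_le_left _ _
  have hmgf : mgf (∑ i, X i) μ t ≤ Real.exp (t * E + expSqMoment * t ^ 2) ^ m := by
    rw [hind.mgf_sum hX]
    calc _ ≤ ∏ i : Fin m, Real.exp (t * E + expSqMoment * t ^ 2) :=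
          Finset.prod_le_prod (fun i _ => mgf_nonneg) fun i _ => by
            simpa [hE i] using mgf_le_of_le_sq (hG i) (hX i).aemeasurable (h0 i) (h1 i) ht8
      _ = _ := by simp
  have hint : Integrable (fun ω => Real.exp (t * (∑ i, X i) ω)) μ :=
    hind.integrable_exp_mul_sum hX fun i _ =>
      integrable_exp_mul_of_le_sq (hG i) (hX i).aemeasurable (h0 i) (h1 i) ht8
  have := measure_ge_le_exp_mul_mgf (μ := μ) (X := ∑ i, X i) (m * (E + η)) ht0.le hint
  simp only [Finset.sum_apply] at this
  refine this.trans ((mul_le_mul_of_nonneg_left hmgf (Real.exp_pos _).le).trans ?_)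
  rw [← Real.exp_nat_mul, ← Real.exp_add]
  apply Real.exp_le_exp.2
  have hr := rate_le hη
  have : (0 : ℝ) ≤ m := by positivity
  nlinarith

theorem measure_sum_le_le {m : ℕ} {X G : Fin m → Ω → ℝ} {E η : ℝ} (hη : 0 < η)
    (hind : iIndepFun X μ) (hG : ∀ i, HasLaw (G i) (gaussianReal 0 1) μ)
    (hX : ∀ i, Measurable (X i)) (h0 : ∀ i ω, 0 ≤ X i ω) (h1 : ∀ i ω, X i ω ≤ G i ω ^ 2)
    (hE : ∀ i, μ[X i] = E) :
    μ.real {ω | ∑ i, X i ω ≤ m * (E - η)} ≤ Real.exp (-(rate η * m)) := by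
  set t := min (1 / 8) (η / (2 * expSqMoment)) with ht
  have hC := expSqMoment_pos
  have ht0 : 0 < t := by positivity
  have ht8 : |-t| ≤ 1 / 8 := by rw [abs_neg, abs_of_pos ht0]; exact min_le_left _ _
  have hmgf : mgf (∑ i, X i) μ (-t) ≤ Real.exp (-t * E + expSqMoment * t ^ 2) ^ m := by
    rw [hind.mgf_sum hX]
    calc _ ≤ ∏ i : Fin m, Real.exp (-t * E + expSqMoment * t ^ 2) :=
          Finset.prod_le_prod (fun i _ => mgf_nonneg) fun i _ => by
            simpa [hE i] using mgf_le_of_le_sq (hG i) (hX i).aemeasurable (h0 i) (h1 i) ht8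
      _ = _ := by simp
  have hint : Integrable (fun ω => Real.exp (-t * (∑ i, X i) ω)) μ :=
    hind.integrable_exp_mul_sum hX fun i _ =>
      integrable_exp_mul_of_le_sq (hG i) (hX i).aemeasurable (h0 i) (h1 i) ht8
  have := measure_le_le_exp_mul_mgf (μ := μ) (X := ∑ i, X i) (m * (E - η)) (neg_nonpos.2 ht0.le) hint
  simp only [Finset.sum_apply] at this
  refine this.trans ((mul_le_mul_of_nonneg_left hmgf (Real.exp_pos _).le).trans ?_)
  rw [← Real.exp_nat_mul, ← Real.exp_add]
  apply Real.exp_le_exp.2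
  have hr := rate_le hη
  have : (0 : ℝ) ≤ m := by positivity
  nlinarith

end Chernoff

/-! ### Nets of the unit sphere -/

section Net

open Metric Module

variable {E : Type*} [NormedAddCommGroup E] [NormedSpace ℝ E] [FiniteDimensional ℝ E]

/-- Volume comparison: the balls of radius `ε / 2` about the points are disjoint and fit in the ball
of radius `1 + ε / 2`. -/
theorem card_le_of_separated_sphere {ε : ℝ} (hε : 0 < ε) (s : Finset E)
    (hs : ∀ c ∈ s, ‖c‖ = 1) (h : ∀ c ∈ s, ∀ d ∈ s, c ≠ d → ε ≤ ‖c - d‖) :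
    (s.card : ℝ) ≤ (1 + 2 / ε) ^ finrank ℝ E := by
  borelize E
  let μ : Measure E := Measure.addHaar
  have hδ : 0 < ε / 2 := by positivity
  have hρ : 0 < 1 + ε / 2 := by positivity
  have hdisj : Set.Pairwise (s : Set E) (Function.onFun Disjoint fun c => ball (c : E) (ε / 2)) := by
    rintro c hc d hd hcd
    apply ball_disjoint_ball
    rw [dist_eq_norm]
    linarith [h c hc d hd hcd]
  have hsub : (⋃ c ∈ s, ball (c : E) (ε / 2)) ⊆ ball (0 : E) (1 + ε / 2) := by
    refine Set.iUnion₂_subset fun x hx => ball_subset_ball' ?_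
    rw [dist_zero_right, hs x hx, add_comm]
  have hI : (s.card : ENNReal) * ENNReal.ofReal ((ε / 2) ^ finrank ℝ E) * μ (ball 0 1) ≤
      ENNReal.ofReal ((1 + ε / 2) ^ finrank ℝ E) * μ (ball 0 1) :=
    calc (s.card : ENNReal) * ENNReal.ofReal ((ε / 2) ^ finrank ℝ E) * μ (ball 0 1)
        = μ (⋃ c ∈ s, ball (c : E) (ε / 2)) := by
          rw [measure_biUnion_finset hdisj fun c _ => measurableSet_ball]
          simp only [μ.addHaar_ball_of_pos _ hδ, Finset.sum_const, nsmul_eq_mul, mul_assoc]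
      _ ≤ μ (ball (0 : E) (1 + ε / 2)) := measure_mono hsub
      _ = _ := μ.addHaar_ball_of_pos _ hρ
  have hJ := (ENNReal.mul_le_mul_iff_left (measure_ball_pos _ _ zero_lt_one).ne'
    measure_ball_lt_top.ne).1 hI
  have hK := ENNReal.toReal_le_of_le_ofReal (pow_nonneg hρ.le _) hJ
  rw [ENNReal.toReal_mul, ENNReal.toReal_natCast, ENNReal.toReal_ofReal (by positivity),
    ← le_div_iff₀ (by positivity), ← div_pow] at hK
  convert! hK using 2
  field_simp
  ring

theorem exists_sphere_net {ε : ℝ} (hε : 0 < ε) :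
    ∃ s : Finset E, (∀ c ∈ s, ‖c‖ = 1) ∧ (s.card : ℝ) ≤ (1 + 2 / ε) ^ finrank ℝ E ∧
      ∀ v : E, ‖v‖ = 1 → ∃ c ∈ s, ‖v - c‖ < ε := by
  classical
  let P : Finset E → Prop := fun s =>
    (∀ c ∈ s, ‖c‖ = 1) ∧ ∀ c ∈ s, ∀ d ∈ s, c ≠ d → ε ≤ ‖c - d‖
  let K : Set ℕ := {k | ∃ s, P s ∧ s.card = k}
  have hne : K.Nonempty := ⟨0, ∅, by simp [P], rfl⟩
  have hbdd : BddAbove K := by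
    refine ⟨⌊(1 + 2 / ε) ^ finrank ℝ E⌋₊, ?_⟩
    rintro _ ⟨s, hs, rfl⟩
    exact Nat.le_floor (card_le_of_separated_sphere hε s hs.1 hs.2)
  -- A separated set of largest cardinality is a net: a point far from all its members could be
  -- added.
  obtain ⟨s, hs, hcard⟩ := Nat.sSup_mem hne hbdd
  refine ⟨s, hs.1, card_le_of_separated_sphere hε s hs.1 hs.2, fun v hv => ?_⟩
  by_contra! hfar
  have hvs : v ∉ s := fun hmem => by simpa [hε.not_ge] using hfar v hmem
  have hP : P (insert v s) := by
    constructor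
    · intro c hc
      rcases Finset.mem_insert.1 hc with rfl | hc
      exacts [hv, hs.1 c hc]
    · intro c hc d hd hcd
      rcases Finset.mem_insert.1 hc with rfl | hc' <;> rcases Finset.mem_insert.1 hd with rfl | hd'
      · exact absurd rfl hcd
      · exact hfar d hd'
      · rw [norm_sub_rev]; exact hfar c hc'
      · exact hs.2 c hc' d hd' hcd
  have := le_csSup hbdd ⟨insert v s, hP, rfl⟩
  rw [Finset.card_insert_of_notMem hvs, ← hcard] at this
  omega

end Net

/-! ### Extending quadratic bounds from a net to the sphere -/

section Quadratic

variable {E : Type*} [NormedAddCommGroup E] [InnerProductSpace ℝ E]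

theorem sq_inner_sub_sq_inner_le {e u v : E} (he : ‖e‖ = 1) (hu : ‖u‖ = 1) (hv : ‖v‖ = 1) :
    inner ℝ u e ^ 2 - inner ℝ v e ^ 2 ≤ 2 * ‖v - u‖ := by
  have h1 := abs_real_inner_le_norm u e
  have h2 := abs_real_inner_le_norm v e
  have h3 := abs_real_inner_le_norm (v - u) e
  rw [inner_sub_left] at h3
  simp only [he, hu, hv, mul_one] at h1 h2 h3
  rw [abs_le] at h1 h2
  have h4 : |inner ℝ u e + inner ℝ v e| ≤ 2 := abs_le.2 ⟨by linarith, by linarith⟩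
  calc inner ℝ u e ^ 2 - inner ℝ v e ^ 2
      ≤ |inner ℝ u e ^ 2 - inner ℝ v e ^ 2| := le_abs_self _
    _ = |inner ℝ v e - inner ℝ u e| * |inner ℝ u e + inner ℝ v e| := by
        rw [← abs_mul, ← abs_neg]; ring_nf
    _ ≤ ‖v - u‖ * 2 := by gcongr
    _ = _ := mul_comm _ _

/-- A bound on a nonnegative quadratic form `‖A v‖²` at the points of a net of the unit sphere
extends to the whole sphere. -/
theorem norm_sq_le_of_net {F : Type*} [NormedAddCommGroup F] [NormedSpace ℝ F]
    (A : E →L[ℝ] F) {N : Set E} {ε p r η : ℝ} {e : E} (he : ‖e‖ = 1) (hε0 : 0 < ε)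
    (hε : ε ≤ 1 / 2) (hp : 0 ≤ p) (hpr : p ≤ r) (hη : 0 ≤ η)
    (hN1 : ∀ c ∈ N, ‖c‖ = 1) (hN : ∀ v : E, ‖v‖ = 1 → ∃ c ∈ N, ‖v - c‖ < ε)
    (hA : ∀ c ∈ N, ‖A c‖ ^ 2 ≤ p + (r - p) * inner ℝ c e ^ 2 + η) {v : E} (hv : ‖v‖ = 1) :
    ‖A v‖ ^ 2 ≤ p + (r - p) * inner ℝ v e ^ 2 + η + 10 * (r + η) * ε := by
  set B := Real.sqrt (r + η) with hB
  have hB2 : B ^ 2 = r + η := Real.sq_sqrt (by linarith)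
  have hB0 : 0 ≤ B := Real.sqrt_nonneg _
  have hAB : ∀ c ∈ N, ‖A c‖ ≤ B := by
    intro c hc
    apply Real.le_sqrt_of_sq_le
    have h1 := abs_real_inner_le_norm c e
    rw [he, hN1 c hc, mul_one, ← sq_le_one_iff_abs_le_one] at h1
    have := hA c hc
    nlinarith
  have hstep : ∀ v : E, ‖v‖ = 1 → ∃ c ∈ N, ‖A v‖ ≤ ‖A c‖ + ‖A‖ * ε ∧ ‖v - c‖ < ε := by
    intro v hv
    obtain ⟨c, hc, hvc⟩ := hN v hv
    refine ⟨c, hc, ?_, hvc⟩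
    calc ‖A v‖ = ‖A c + A (v - c)‖ := by simp
      _ ≤ ‖A c‖ + ‖A (v - c)‖ := norm_add_le _ _
      _ ≤ ‖A c‖ + ‖A‖ * ε := by
        gcongr
        exact (A.le_opNorm _).trans (by gcongr)
  -- The operator norm appears on both sides and is absorbed using `ε ≤ 1/2`.
  have hK : ‖A‖ ≤ 2 * B := by
    have : ‖A‖ ≤ B + ‖A‖ * ε := by
      refine A.opNorm_le_of_unit_norm (by positivity) fun v hv => ?_
      obtain ⟨c, hc, h, -⟩ := hstep v hv
      linarith [hAB c hc]
    nlinarith [norm_nonneg A]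
  obtain ⟨c, hc, h1, h2⟩ := hstep v hv
  have h3 : inner ℝ c e ^ 2 - inner ℝ v e ^ 2 ≤ 2 * ε :=
    (sq_inner_sub_sq_inner_le he (hN1 c hc) hv).trans (by linarith)
  have h4 : ‖A v‖ ^ 2 ≤ ‖A c‖ ^ 2 + 8 * B ^ 2 * ε := by
    have h5 : ‖A v‖ ≤ ‖A c‖ + 2 * B * ε := h1.trans (by gcongr)
    have h6 := hAB c hc
    have h7 : ‖A v‖ ^ 2 ≤ (‖A c‖ + 2 * B * ε) ^ 2 := by gcongr
    have h8 : B * ε * ‖A c‖ ≤ B * ε * B := by gcongr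
    have h9 : B ^ 2 * ε * ε ≤ B ^ 2 * ε * (1 / 2) := by gcongr
    nlinarith [mul_nonneg (sq_nonneg B) hε0.le]
  have h10 := hA c hc
  have h11 : (r - p) * inner ℝ c e ^ 2 ≤ (r - p) * (inner ℝ v e ^ 2 + 2 * ε) := by
    have : 0 ≤ r - p := by linarith
    gcongr
    linarith
  rw [hB2] at h4
  nlinarith [mul_nonneg hp hε0.le, mul_nonneg hη hε0.le]

end Quadratic

/-! ### Power iteration for positive operators -/

section PowerIteration

variable {E : Type*} [NormedAddCommGroup E] [InnerProductSpace ℝ E]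

/-- Cauchy–Schwarz for the semi-inner product of a positive operator, read off from the discriminant
of `t ↦ ⟨T (w + t u), w + t u⟩`. -/
theorem sq_inner_map_le {T : E →ₗ[ℝ] E} (hT : T.IsSymmetric) (hpos : ∀ u, 0 ≤ inner ℝ (T u) u)
    (w u : E) : inner ℝ (T w) u ^ 2 ≤ inner ℝ (T w) w * inner ℝ (T u) u := by
  have h : ∀ t : ℝ, 0 ≤ inner ℝ (T u) u * (t * t) + 2 * inner ℝ (T w) u * t + inner ℝ (T w) w := by
    intro t
    have h1 := hpos (w + t • u)
    have h2 : inner ℝ (T u) w = inner ℝ (T w) u := by rw [hT u w, real_inner_comm]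
    simp only [map_add, map_smul, inner_add_left, inner_add_right, inner_smul_left,
      inner_smul_right, h2] at h1
    simp only [conj_trivial] at h1
    linarith
  have := discrim_le_zero h
  rw [discrim] at this
  nlinarith

/-- Apply the preceding inequality to `w` and `T w`. Only the form at these two vectors is needed,
so the lemma applies on an invariant subspace without restricting the operator to it. -/
theorem norm_map_le_of_form_le {T : E →ₗ[ℝ] E} (hT : T.IsSymmetric)
    (hpos : ∀ u, 0 ≤ inner ℝ (T u) u) {κ : ℝ} (hκ : 0 ≤ κ) {w : E}
    (h1 : inner ℝ (T w) w ≤ κ * ‖w‖ ^ 2) (h2 : inner ℝ (T (T w)) (T w) ≤ κ * ‖T w‖ ^ 2) :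
    ‖T w‖ ≤ κ * ‖w‖ := by
  have h := sq_inner_map_le hT hpos w (T w)
  rw [real_inner_self_eq_norm_sq] at h
  have h3 : inner ℝ (T w) w * inner ℝ (T (T w)) (T w) ≤ κ * ‖w‖ ^ 2 * (κ * ‖T w‖ ^ 2) :=
    mul_le_mul h1 h2 (hpos _) (by positivity)
  rcases (norm_nonneg (T w)).eq_or_lt with h0 | h0
  · rw [← h0]; positivity
  · refine le_of_sq_le_sq ?_ (by positivity)
    have : ‖T w‖ ^ 2 * ‖T w‖ ^ 2 ≤ (κ * ‖w‖) ^ 2 * ‖T w‖ ^ 2 := by nlinarith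
    exact le_of_mul_le_mul_right this (by positivity)

theorem map_eq_smul_of_max [FiniteDimensional ℝ E] {T : E →ₗ[ℝ] E} (hT : T.IsSymmetric)
    {v : E} (hv : ‖v‖ = 1) (hmax : ∀ u, ‖u‖ = 1 → inner ℝ (T u) u ≤ inner ℝ (T v) v) :
    T v = inner ℝ (T v) v • v := by
  have hsa : IsSelfAdjoint (LinearMap.toContinuousLinearMap T) := hT.isSelfAdjoint
  have hv0 : v ≠ 0 := by rintro rfl; simp at hv
  have hext : IsMaxOn (LinearMap.toContinuousLinearMap T).reApplyInnerSelf
      (Metric.sphere (0 : E) ‖v‖) v := by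
    intro u hu
    rw [mem_sphere_zero_iff_norm, hv] at hu
    simpa [ContinuousLinearMap.reApplyInnerSelf_apply] using hmax u hu
  have h := (hsa.hasEigenvector_of_isMaxOn hv0 hext).apply_eq_smul
  set l : ℝ := ⨆ x : { x : E // x ≠ 0 }, (LinearMap.toContinuousLinearMap T).rayleighQuotient x
  have h' : T v = l • v := by simpa using h
  rw [h', inner_smul_left, real_inner_self_eq_norm_sq, hv]
  simp

theorem exists_unit_max [FiniteDimensional ℝ E] [Nontrivial E] (T : E →ₗ[ℝ] E) :
    ∃ v : E, ‖v‖ = 1 ∧ ∀ u, ‖u‖ = 1 → inner ℝ (T u) u ≤ inner ℝ (T v) v := by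
  have : ProperSpace E := FiniteDimensional.proper_real E
  have hc : Continuous fun u => inner ℝ (T u) u :=
    T.continuous_of_finiteDimensional.inner continuous_id
  obtain ⟨v, hv, hmax⟩ := (isCompact_sphere (0 : E) 1).exists_isMaxOn
    (NormedSpace.sphere_nonempty.2 zero_le_one) hc.continuousOn
  exact ⟨v, by simpa using hv, fun u hu => hmax (by simpa using hu)⟩

/-- Normalized power iteration contracts towards an eigenvector `v` whenever the operator is
smaller on the orthogonal complement of `v`. -/
theorem power_iteration_contracts {T : E →ₗ[ℝ] E} (hT : T.IsSymmetric) {v : E} (hv : ‖v‖ = 1)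
    {l κ ρ ε : ℝ} (hl : 0 < l) (hTv : T v = l • v) (hκρ : κ ≤ ρ * l) (hρ : 0 ≤ ρ)
    (hκ : ∀ w, inner ℝ w v = 0 → ‖T w‖ ≤ κ * ‖w‖) (hε : 0 < ε) {z : ℕ → E}
    (h0 : ‖z 0‖ = 1) (hz0 : ε ≤ |inner ℝ (z 0) v|)
    (hz : ∀ t, z (t + 1) = ‖T (z t)‖⁻¹ • T (z t)) (t : ℕ) :
    ‖z t‖ = 1 ∧ inner ℝ (z t) v ≠ 0 ∧
      ‖z t - inner ℝ (z t) v • v‖ ≤ ρ ^ t / ε * |inner ℝ (z t) v| := by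
  have hvv : inner ℝ v v = 1 := by rw [real_inner_self_eq_norm_sq, hv]; norm_num
  have horth : ∀ y : E, inner ℝ (y - inner ℝ y v • v) v = 0 := fun y => by
    rw [inner_sub_left, inner_smul_left, hvv]; simp
  -- The last conjunct bounds the tangent of the angle to `v`. Normalization cancels from it, and
  -- each step multiplies the bound by `ρ`.
  induction t with
  | zero =>
    refine ⟨h0, fun h => ?_, ?_⟩
    · rw [h, abs_zero] at hz0; linarith
    · have h1 : ‖z 0 - inner ℝ (z 0) v • v‖ ^ 2 = 1 - inner ℝ (z 0) v ^ 2 := by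
        rw [norm_sub_sq_real, h0, norm_smul, hv, inner_smul_right, Real.norm_eq_abs, mul_one, sq_abs]
        ring
      have h2 : ‖z 0 - inner ℝ (z 0) v • v‖ ≤ 1 := by
        refine le_of_sq_le_sq ?_ zero_le_one
        rw [h1]
        nlinarith [sq_nonneg (inner ℝ (z 0) v : ℝ)]
      refine h2.trans ?_
      rw [pow_zero, div_mul_eq_mul_div, one_mul, one_le_div hε]
      exact hz0
  | succ t ih =>
    obtain ⟨-, hne, hle⟩ := ih
    have hTs : inner ℝ (T (z t)) v = l * inner ℝ (z t) v := by
      rw [hT, hTv, inner_smul_right]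
    have hTne : T (z t) ≠ 0 := by
      intro h
      rw [h, inner_zero_left] at hTs
      exact mul_ne_zero hl.ne' hne hTs.symm
    have hnpos : 0 < ‖T (z t)‖ := norm_pos_iff.2 hTne
    have hin : inner ℝ (z (t + 1)) v = ‖T (z t)‖⁻¹ * (l * inner ℝ (z t) v) := by
      rw [hz, inner_smul_left, hTs]; simp
    have hdecomp : z (t + 1) - inner ℝ (z (t + 1)) v • v
        = ‖T (z t)‖⁻¹ • T (z t - inner ℝ (z t) v • v) := by
      rw [hin, hz, map_sub, map_smul, hTv, smul_sub, smul_smul, smul_smul]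
      ring_nf
    refine ⟨?_, ?_, ?_⟩
    · rw [hz, norm_smul, norm_inv, norm_norm, inv_mul_cancel₀ hnpos.ne']
    · rw [hin]
      exact mul_ne_zero (inv_ne_zero hnpos.ne') (mul_ne_zero hl.ne' hne)
    · rw [hdecomp, hin, norm_smul, norm_inv, norm_norm, abs_mul, abs_mul, abs_of_pos hl,
        abs_of_pos (inv_pos.2 hnpos), mul_left_comm]
      gcongr
      calc ‖T (z t - inner ℝ (z t) v • v)‖ ≤ κ * ‖z t - inner ℝ (z t) v • v‖ := hκ _ (horth _)
        _ ≤ (ρ * l) * (ρ ^ t / ε * |inner ℝ (z t) v|) := by gcongr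
        _ = _ := by rw [pow_succ]; ring

/-- The quadratic form at the iterates approaches the top eigenvalue. -/
theorem power_iteration_form_ge {T : E →ₗ[ℝ] E} (hT : T.IsSymmetric)
    (hpos : ∀ u, 0 ≤ inner ℝ (T u) u) {v z : E} (hv : ‖v‖ = 1) (hz : ‖z‖ = 1)
    {l θ : ℝ} (hl : 0 < l) (hTv : T v = l • v)
    (hle : ‖z - inner ℝ z v • v‖ ≤ θ * |inner ℝ z v|) :
    l * (1 - θ ^ 2) ≤ inner ℝ (T z) z := by
  set s : ℝ := inner ℝ z v with hs
  set w : E := z - s • v with hw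
  have hvv : inner ℝ v v = 1 := by rw [real_inner_self_eq_norm_sq, hv]; norm_num
  have hwv : inner ℝ w v = 0 := by rw [hw, inner_sub_left, inner_smul_left, hvv]; simp [hs]
  have hzd : z = s • v + w := by rw [hw]; abel
  have hTw : inner ℝ (T w) v = 0 := by rw [hT, hTv, inner_smul_right, hwv, mul_zero]
  have h1 : inner ℝ (T z) z = l * s ^ 2 + inner ℝ (T w) w := by
    rw [hzd, map_add, map_smul, hTv]
    simp only [inner_add_left, inner_add_right, inner_smul_left, inner_smul_right, hvv, hTw,
      real_inner_comm w v, hwv, conj_trivial]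
    ring
  have h2 : ‖w‖ ^ 2 = 1 - s ^ 2 := by
    rw [hw, norm_sub_sq_real, hz, norm_smul, hv, inner_smul_right, Real.norm_eq_abs, mul_one, sq_abs]
    ring
  have h3 : s ^ 2 ≤ 1 := by nlinarith [sq_nonneg ‖w‖]
  have h4 : ‖w‖ ^ 2 ≤ θ ^ 2 := by
    calc ‖w‖ ^ 2 ≤ (θ * |s|) ^ 2 := by gcongr
      _ = θ ^ 2 * s ^ 2 := by rw [mul_pow, sq_abs]
      _ ≤ θ ^ 2 * 1 := by gcongr
      _ = θ ^ 2 := mul_one _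
  rw [h1]
  have := hpos w
  nlinarith

end PowerIteration

/-! ### Deterministic guarantees -/

section Deterministic

variable {n m : ℕ} {α β : ℝ}

/-- The weighted sample covariance as a linear map. -/
def weightedCovLin (α β : ℝ) (a : Fin m → EuclideanSpace ℝ (Fin n)) (y : Fin m → ℝ) :
    EuclideanSpace ℝ (Fin n) →ₗ[ℝ] EuclideanSpace ℝ (Fin n) where
  toFun := weightedCov α β a y
  map_add' u v := by
    simp [weightedCov, inner_add_right, mul_add, add_smul, Finset.sum_add_distrib]
  map_smul' c u := by
    simp only [weightedCov, inner_smul_right, Finset.smul_sum, smul_smul, RingHom.id_apply]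
    refine Finset.sum_congr rfl fun i _ => ?_
    congr 1
    ring

theorem inner_weightedCovLin (a : Fin m → EuclideanSpace ℝ (Fin n)) (y : Fin m → ℝ)
    (u v : EuclideanSpace ℝ (Fin n)) :
    inner ℝ (weightedCovLin α β a y u) v
      = ∑ i, weight α β y i * inner ℝ (a i) u * inner ℝ (a i) v := by
  change inner ℝ (weightedCov α β a y u) v = _
  simp [weightedCov, sum_inner, inner_smul_left]

theorem isSymmetric_weightedCovLin (a : Fin m → EuclideanSpace ℝ (Fin n)) (y : Fin m → ℝ) :
    (weightedCovLin α β a y).IsSymmetric := by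
  intro u v
  rw [inner_weightedCovLin, real_inner_comm, inner_weightedCovLin]
  exact Finset.sum_congr rfl fun i _ => by ring

theorem inner_weightedCovLin_self (hm : m ≠ 0) (a : Fin m → EuclideanSpace ℝ (Fin n))
    (y : Fin m → ℝ) (u : EuclideanSpace ℝ (Fin n)) :
    inner ℝ (weightedCovLin α β a y u) u = m * rayleigh α β a y u := by
  have : (m : ℝ) ≠ 0 := by exact_mod_cast hm
  rw [inner_weightedCovLin, rayleigh, ← mul_assoc, mul_one_div_cancel this, one_mul]
  exact Finset.sum_congr rfl fun i _ => by ring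

theorem intensity_nonneg (a : Fin m → EuclideanSpace ℝ (Fin n)) (x : EuclideanSpace ℝ (Fin n))
    (i : Fin m) : 0 ≤ intensity a x i := by
  unfold intensity; positivity

theorem sampleMean_nonneg {y : Fin m → ℝ} (hy : ∀ i, 0 ≤ y i) : 0 ≤ sampleMean y :=
  mul_nonneg (by positivity) (Finset.sum_nonneg fun i _ => hy i)

theorem weight_nonneg (hα : 0 < α) {y : Fin m → ℝ} (hy : ∀ i, 0 ≤ y i) (i : Fin m) :
    0 ≤ weight α β y i := by
  rw [weight_eq_profile]
  exact profile_nonneg hα (sampleMean_nonneg hy) (hy i)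

theorem rayleigh_nonneg (hα : 0 < α) (a : Fin m → EuclideanSpace ℝ (Fin n)) {y : Fin m → ℝ}
    (hy : ∀ i, 0 ≤ y i) (u : EuclideanSpace ℝ (Fin n)) : 0 ≤ rayleigh α β a y u :=
  mul_nonneg (by positivity)
    (Finset.sum_nonneg fun i _ => mul_nonneg (weight_nonneg hα hy i) (sq_nonneg _))

theorem rayleigh_smul (a : Fin m → EuclideanSpace ℝ (Fin n)) (y : Fin m → ℝ) (c : ℝ)
    (u : EuclideanSpace ℝ (Fin n)) : rayleigh α β a y (c • u) = c ^ 2 * rayleigh α β a y u := by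
  simp only [rayleigh, inner_smul_right, mul_pow, Finset.mul_sum]
  exact Finset.sum_congr rfl fun i _ => by ring

/-- The sample behaves like its population: the quadratic form is at most
`p + (r - p) ⟨u, e⟩² + η` on the sphere and at least `r - η` at `e`, while the sample mean is
within `τ` of `‖x‖²` in relative terms. -/
structure WellSpread (α β p r η τ : ℝ) (x e : EuclideanSpace ℝ (Fin n))
    (a : Fin m → EuclideanSpace ℝ (Fin n)) : Prop where
  mean : |sampleMean (intensity a x) - ‖x‖ ^ 2| ≤ τ * ‖x‖ ^ 2
  upper : ∀ u, ‖u‖ = 1 → rayleigh α β a (intensity a x) u ≤ p + (r - p) * inner ℝ u e ^ 2 + η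
  lower : r - η ≤ rayleigh α β a (intensity a x) e

/-- The error splits into a radial part, at most `τ ‖x‖`, and an angular part: once the sign is
fixed, `‖z - e‖² = 2 - 2 ⟨z, e⟩ ≤ 2 θ`. -/
theorem signDist_rescale_le {τ θ δ : ℝ} {y : Fin m → ℝ} {x e z : EuclideanSpace ℝ (Fin n)}
    (he : ‖e‖ = 1) (hx : x = ‖x‖ • e) (hz : ‖z‖ = 1) (hτ0 : 0 ≤ τ) (hτ : τ ≤ δ / 2)
    (hθ : 2 * θ ≤ (δ / 2) ^ 2) (hy : 0 ≤ sampleMean y)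
    (hmean : |sampleMean y - ‖x‖ ^ 2| ≤ τ * ‖x‖ ^ 2) (hze : 1 - θ ≤ inner ℝ z e ^ 2) :
    signDist (rescale y z) x ≤ δ * ‖x‖ := by
  wlog h0 : 0 ≤ inner ℝ z e generalizing z
  · have h := this (z := -z) (by simpa using hz) (by simpa using hze)
      (by rw [inner_neg_left]; linarith)
    refine le_trans (le_of_eq ?_) h
    have e1 : rescale y (-z) = -rescale y z := by simp [rescale]
    rw [e1, signDist, signDist, min_comm]
    congr 1
    · rw [← norm_neg]; congr 1; abel
    · rw [← norm_neg]; congr 1; abel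
  have hδ : 0 ≤ δ / 2 := hτ0.trans hτ
  have h1 : inner ℝ z e ≤ 1 := by
    have := real_inner_le_norm z e
    rwa [hz, he, mul_one] at this
  have h2 : ‖z - e‖ ≤ δ / 2 := by
    refine le_of_sq_le_sq ?_ hδ
    rw [norm_sub_sq_real, hz, he]
    nlinarith
  have h3 : |Real.sqrt (sampleMean y) - ‖x‖| ≤ τ * ‖x‖ := by
    set q := Real.sqrt (sampleMean y) with hq
    have hq2 : q ^ 2 = sampleMean y := Real.sq_sqrt hy
    have hq0 : 0 ≤ q := Real.sqrt_nonneg _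
    rcases (norm_nonneg x).eq_or_lt with hx0 | hx0
    · rw [← hx0] at hmean ⊢
      have : q ^ 2 = 0 := by rw [hq2]; simpa using hmean
      simp [pow_eq_zero_iff] at this
      simp [this]
    · rw [← hq2, show q ^ 2 - ‖x‖ ^ 2 = (q - ‖x‖) * (q + ‖x‖) by ring, abs_mul,
        abs_of_nonneg (by positivity : 0 ≤ q + ‖x‖)] at hmean
      have : |q - ‖x‖| * ‖x‖ ≤ τ * ‖x‖ * ‖x‖ := by
        nlinarith [abs_nonneg (q - ‖x‖), mul_nonneg (abs_nonneg (q - ‖x‖)) hq0]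
      exact le_of_mul_le_mul_right this hx0
  refine (min_le_left _ _).trans ?_
  calc ‖rescale y z - x‖
      = ‖(Real.sqrt (sampleMean y) - ‖x‖) • z + ‖x‖ • (z - e)‖ := by
        conv_lhs => rw [hx]
        rw [rescale, sub_smul, smul_sub]
        congr 1
        abel
    _ ≤ ‖(Real.sqrt (sampleMean y) - ‖x‖) • z‖ + ‖‖x‖ • (z - e)‖ := norm_add_le _ _
    _ = |Real.sqrt (sampleMean y) - ‖x‖| + ‖x‖ * ‖z - e‖ := by
        rw [norm_smul, norm_smul, hz, mul_one, norm_norm, Real.norm_eq_abs]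
    _ ≤ τ * ‖x‖ + ‖x‖ * (δ / 2) := by gcongr
    _ ≤ δ / 2 * ‖x‖ + ‖x‖ * (δ / 2) := by gcongr
    _ = δ * ‖x‖ := by ring

variable {p r η τ δ : ℝ} {x e : EuclideanSpace ℝ (Fin n)}
  {a : Fin m → EuclideanSpace ℝ (Fin n)}

/-- Comparing the lower bound at `z` with the upper bound on the sphere gives `1 - ⟨z, e⟩² ≤ 3 η /
(r - p)`. The slack `2 η` leaves room for vectors that maximize the form only approximately. -/
theorem WellSpread.signDist_le (h : WellSpread α β p r η τ x e a) (hpr : p < r)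
    (he : ‖e‖ = 1) (hx : x = ‖x‖ • e) (hτ0 : 0 ≤ τ) (hτ : τ ≤ δ / 2)
    (hη : 24 * η ≤ δ ^ 2 * (r - p)) {z : EuclideanSpace ℝ (Fin n)} (hz : ‖z‖ = 1)
    (hR : r - 2 * η ≤ rayleigh α β a (intensity a x) z) :
    signDist (rescale (intensity a x) z) x ≤ δ * ‖x‖ := by
  have hrp : 0 < r - p := sub_pos.2 hpr
  refine signDist_rescale_le (θ := 3 * η / (r - p)) he hx hz hτ0 hτ ?_
    (sampleMean_nonneg (intensity_nonneg a x)) h.mean ?_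
  · rw [mul_div_assoc', div_le_iff₀ hrp]
    nlinarith
  · have h1 := h.upper z hz
    rw [sub_le_comm, le_div_iff₀ hrp]
    nlinarith

theorem WellSpread.signDist_leading_le (h : WellSpread α β p r η τ x e a) (hpr : p < r)
    (he : ‖e‖ = 1) (hx : x = ‖x‖ • e) (hτ0 : 0 ≤ τ) (hτ : τ ≤ δ / 2) (hη0 : 0 ≤ η)
    (hη : 24 * η ≤ δ ^ 2 * (r - p)) {v : EuclideanSpace ℝ (Fin n)}
    (hv : IsLeadingEigenvector α β a (intensity a x) v) :
    signDist (rescale (intensity a x) v) x ≤ δ * ‖x‖ := by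
  refine h.signDist_le hpr he hx hτ0 hτ hη hv.1 ?_
  have := hv.2 e he
  linarith [h.lower]

/-- On a well-spread sample there is a direction `v` such that power iteration started with
overlap at least `ε` with `v` succeeds after `T` steps. -/
theorem WellSpread.exists_direction (h : WellSpread α β p r η τ x e a) (hα : 0 < α)
    (hm : m ≠ 0) (hp : 0 ≤ p) (hpr : p < r)
    (he : ‖e‖ = 1) (hx : x = ‖x‖ • e) (hτ0 : 0 ≤ τ) (hτ : τ ≤ δ / 2) (hη0 : 0 < η)
    (hη8 : 8 * η ≤ r - p) (hη : 24 * η ≤ δ ^ 2 * (r - p)) {ρ ε : ℝ} (hρ0 : 0 ≤ ρ)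
    (hρ : p + 3 * η ≤ ρ * (r - η)) (hε : 0 < ε) {T : ℕ} (hT : (ρ ^ T / ε) ^ 2 * r ≤ η) :
    ∃ v : EuclideanSpace ℝ (Fin n), ‖v‖ = 1 ∧ ∀ g : EuclideanSpace ℝ (Fin n), g ≠ 0 →
      ε * ‖g‖ ≤ |inner ℝ v g| →
      signDist (rescale (intensity a x) (powerIterate α β a (intensity a x) g T)) x
        ≤ δ * ‖x‖ := by
  have hrp : 0 < r - p := sub_pos.2 hpr
  have : Nontrivial (EuclideanSpace ℝ (Fin n)) :=
    ⟨e, 0, by rintro rfl; simp at he⟩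
  set y := intensity a x with hy
  have hy0 : ∀ i, 0 ≤ y i := intensity_nonneg a x
  set L := weightedCovLin α β a y with hL
  have hm0 : (0 : ℝ) < m := by exact_mod_cast Nat.pos_of_ne_zero hm
  have hform : ∀ u, inner ℝ (L u) u = m * rayleigh α β a y u := inner_weightedCovLin_self hm a y
  have hpos : ∀ u, 0 ≤ inner ℝ (L u) u := fun u => by
    rw [hform]; exact mul_nonneg hm0.le (rayleigh_nonneg hα a hy0 u)
  have hsym : L.IsSymmetric := isSymmetric_weightedCovLin a y
  obtain ⟨v, hv, hmax⟩ := exists_unit_max L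
  refine ⟨v, hv, fun g hg hgv => ?_⟩
  set R := rayleigh α β a y v with hR
  have hLv : L v = (m * R) • v := by rw [hR, ← hform]; exact map_eq_smul_of_max hsym hv hmax
  have hRe : r - η ≤ R := by
    have := hmax e he
    rw [hform, hform] at this
    exact h.lower.trans (le_of_mul_le_mul_left this hm0)
  have hR0 : 0 < R := by linarith
  have hve : (r - p) * (1 - inner ℝ v e ^ 2) ≤ 2 * η := by
    have := h.upper v hv
    nlinarith
  -- A vector orthogonal to `v` sees only the component of `e` orthogonal to `v`, which is small
  -- because `v` is nearly aligned with `e`.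
  have hwe : ∀ w, inner ℝ w v = 0 → inner ℝ w e ^ 2 ≤ ‖w‖ ^ 2 * (1 - inner ℝ v e ^ 2) := by
    intro w hw
    have hvv : inner ℝ v v = 1 := by rw [real_inner_self_eq_norm_sq, hv]; norm_num
    have h1 : inner ℝ w e = inner ℝ w (e - inner ℝ v e • v) := by
      rw [inner_sub_right, inner_smul_right, hw]; ring
    have h2 : ‖e - inner ℝ v e • v‖ ^ 2 = 1 - inner ℝ v e ^ 2 := by
      rw [norm_sub_sq_real, he, norm_smul, hv, inner_smul_right, Real.norm_eq_abs, mul_one,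
        sq_abs, real_inner_comm v e]
      ring
    rw [h1, ← h2, ← mul_pow]
    exact sq_le_sq' (by linarith [neg_abs_le (inner ℝ w (e - inner ℝ v e • v)),
      abs_real_inner_le_norm w (e - inner ℝ v e • v)]) (real_inner_le_norm _ _)
  -- Of the `3 η`, one is the slack of the upper bound and two come from the misalignment of `v` and
  -- `e`.
  have hw1 : ∀ w, inner ℝ w v = 0 → inner ℝ (L w) w ≤ m * (p + 3 * η) * ‖w‖ ^ 2 := by
    intro w hw
    rcases eq_or_ne w 0 with rfl | hw0
    · simp
    have hn : 0 < ‖w‖ := norm_pos_iff.2 hw0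
    have h1 := h.upper (‖w‖⁻¹ • w) (by rw [norm_smul, norm_inv, norm_norm, inv_mul_cancel₀ hn.ne'])
    rw [rayleigh_smul, inner_smul_left, conj_trivial, mul_pow, inv_pow,
      inv_mul_le_iff₀ (by positivity)] at h1
    have h2 : ‖w‖ ^ 2 * (p + (r - p) * ((‖w‖ ^ 2)⁻¹ * inner ℝ w e ^ 2) + η)
        = ‖w‖ ^ 2 * (p + η) + (r - p) * inner ℝ w e ^ 2 := by
      field_simp
      ring
    rw [h2] at h1
    have h3 : (r - p) * inner ℝ w e ^ 2 ≤ ‖w‖ ^ 2 * (2 * η) := by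
      calc (r - p) * inner ℝ w e ^ 2 ≤ (r - p) * (‖w‖ ^ 2 * (1 - inner ℝ v e ^ 2)) := by
            gcongr; exact hwe w hw
        _ = ‖w‖ ^ 2 * ((r - p) * (1 - inner ℝ v e ^ 2)) := by ring
        _ ≤ _ := by gcongr
    rw [hform, mul_assoc]
    gcongr
    linarith
  have hκ : ∀ w, inner ℝ w v = 0 → ‖L w‖ ≤ m * (p + 3 * η) * ‖w‖ := by
    intro w hw
    refine norm_map_le_of_form_le hsym hpos (by positivity) (hw1 w hw) (hw1 _ ?_)
    -- The complement of the eigenvector `v` is invariant, so the form bound also holds at `L w`.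
    rw [hsym, hLv, inner_smul_right, hw, mul_zero]
  have hgn : 0 < ‖g‖ := norm_pos_iff.2 hg
  obtain ⟨hz1, -, hz3⟩ := power_iteration_contracts hsym hv (mul_pos hm0 hR0) hLv
    (κ := m * (p + 3 * η)) (ρ := ρ) (ε := ε)
    (by
      calc (m : ℝ) * (p + 3 * η) ≤ m * (ρ * (r - η)) := by gcongr
        _ ≤ m * (ρ * R) := by gcongr
        _ = _ := by ring)
    hρ0 hκ hε (z := powerIterate α β a y g)
    (by rw [powerIterate, norm_smul, norm_inv, norm_norm, inv_mul_cancel₀ hgn.ne'])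
    (by
      rw [powerIterate, inner_smul_left, conj_trivial, abs_mul, abs_inv, abs_norm,
        real_inner_comm, le_inv_mul_iff₀ hgn, mul_comm]
      exact hgv)
    (fun t => rfl) T
  refine h.signDist_le hpr he hx hτ0 hτ hη hz1 ?_
  have hge := power_iteration_form_ge hsym hpos hv hz1 (mul_pos hm0 hR0) hLv hz3
  rw [hform, mul_assoc] at hge
  have hge' := le_of_mul_le_mul_left hge hm0
  refine le_trans ?_ hge'
  set θ := ρ ^ T / ε
  have hη' : η ≤ r / 8 := by linarith
  have hθ1 : θ ^ 2 ≤ 1 := by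
    by_contra! hc
    nlinarith
  nlinarith [mul_nonneg (sub_nonneg.2 hRe) (sub_nonneg.2 hθ1), mul_nonneg hη0.le (sq_nonneg θ)]

end Deterministic

/-! ### One-dimensional marginals of the standard Gaussian vector -/

section Marginals

variable {E : Type*} [NormedAddCommGroup E] [InnerProductSpace ℝ E] [FiniteDimensional ℝ E]
  [MeasurableSpace E] [BorelSpace E]

theorem hasLaw_inner_stdGaussian {u : E} (hu : ‖u‖ = 1) :
    HasLaw (fun b => inner ℝ b u) (gaussianReal 0 1) (stdGaussian E) where
  aemeasurable := by fun_prop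
  map_eq := by
    have h : (fun b => inner ℝ b u) = ⇑(innerSL ℝ u) := by
      ext b; rw [innerSL_apply_apply, real_inner_comm]
    rw [h, IsGaussian.map_eq_gaussianReal, variance_dual_stdGaussian,
      integral_strongDual_stdGaussian, innerSL_apply_norm, hu]
    simp

theorem integral_inner_stdGaussian (w : E) : ∫ b, inner ℝ b w ∂stdGaussian E = 0 := by
  simpa [real_inner_comm] using integral_strongDual_stdGaussian (innerSL ℝ w)

theorem memLp_inner_stdGaussian (w : E) : MemLp (fun b => inner ℝ b w) 2 (stdGaussian E) := by
  have h := IsGaussian.memLp_dual (stdGaussian E) (innerSL ℝ w) 2 (by simp)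
  refine h.ae_eq (ae_of_all _ fun b => ?_)
  simp [real_inner_comm]

theorem integral_sq_inner_stdGaussian (w : E) :
    ∫ b, inner ℝ b w ^ 2 ∂stdGaussian E = ‖w‖ ^ 2 := by
  have h := variance_dual_stdGaussian (innerSL ℝ w)
  rw [variance_eq_integral (by fun_prop), integral_strongDual_stdGaussian, innerSL_apply_norm] at h
  simpa [real_inner_comm] using h

theorem indepFun_inner_stdGaussian {e w : E} (h : inner ℝ e w = 0) :
    IndepFun (fun b => inner ℝ b e) (fun b => inner ℝ b w) (stdGaussian E) := by
  refine HasGaussianLaw.indepFun_of_covariance_eq_zero ?_ ?_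
  · have : HasGaussianLaw (id : E → E) (stdGaussian E) := ⟨by simpa using isGaussian_stdGaussian⟩
    have h2 := this.map ((innerSL ℝ e).prod (innerSL ℝ w))
    convert! h2 using 1
    ext b <;> simp [real_inner_comm]
  · have h2 := covarianceBilin_apply_eq_cov (μ := stdGaussian E) IsGaussian.memLp_two_id e w
    rw [covarianceBilin_stdGaussian, innerSL_apply_apply, h] at h2
    simpa [real_inner_comm] using h2.symm

variable {α β : ℝ}

/-- Split `u = q e + w` with `w ⊥ e`. The marginals along `e` and `w` are independent, so the cross
term vanishes and the orthogonal part contributes the zeroth moment times `‖w‖² = 1 - q²`. -/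
theorem integral_profile_mul_sq_inner {e u : E} (he : ‖e‖ = 1) (hu : ‖u‖ = 1) (s : ℝ) :
    ∫ b, profile α β s (inner ℝ b e ^ 2) * inner ℝ b u ^ 2 ∂stdGaussian E
      = profileMoment α β s 0
        + (profileMoment α β s 1 - profileMoment α β s 0) * inner ℝ u e ^ 2 := by
  set q : ℝ := inner ℝ u e with hq
  set w : E := u - q • e with hw
  set f : ℝ → ℝ := fun z => profile α β s (z ^ 2) with hf
  have hfm : Measurable f := (measurable_profile s).comp (by fun_prop)
  have hee : inner ℝ e e = 1 := by rw [real_inner_self_eq_norm_sq, he]; norm_num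
  have hew : inner ℝ e w = 0 := by
    rw [hw, inner_sub_right, inner_smul_right, hee, real_inner_comm, ← hq]; ring
  have hnw : ‖w‖ ^ 2 = 1 - q ^ 2 := by
    rw [hw, norm_sub_sq_real, hu, norm_smul, he, inner_smul_right, Real.norm_eq_abs, mul_one, sq_abs]
    ring
  have hind := indepFun_inner_stdGaussian hew
  have hlaw := hasLaw_inner_stdGaussian he
  have hM (k : ℕ) : ∫ b, f (inner ℝ b e) * (inner ℝ b e ^ 2) ^ k ∂stdGaussian E
      = profileMoment α β s k := by
    have := hlaw.integral_comp (f := fun z => f z * (z ^ 2) ^ k)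
      (by fun_prop)
    simpa [Function.comp_def, profileMoment, hf] using this
  have hM0 := hM 0
  have hM1 := hM 1
  simp only [pow_zero, mul_one, pow_one] at hM0 hM1
  have hcross : ∫ b, (f (inner ℝ b e) * inner ℝ b e) * inner ℝ b w ∂stdGaussian E = 0 := by
    have h := (hind.comp (φ := fun z => f z * z) (ψ := id) (by fun_prop) measurable_id)
    have := h.integral_fun_mul_eq_mul_integral
      (by simp only [Function.comp_def]; fun_prop) (by simp only [Function.comp_def, id]; fun_prop)
    simpa [Function.comp_def, integral_inner_stdGaussian] using this
  have hsq : ∫ b, f (inner ℝ b e) * inner ℝ b w ^ 2 ∂stdGaussian E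
      = profileMoment α β s 0 * ‖w‖ ^ 2 := by
    have h := (hind.comp (φ := f) (ψ := fun z => z ^ 2) hfm (by fun_prop))
    have := h.integral_fun_mul_eq_mul_integral
      (hfm.comp (by fun_prop)).aestronglyMeasurable (by simp only [Function.comp_def]; fun_prop)
    simpa [Function.comp_def, integral_sq_inner_stdGaussian, hM0] using this
  have hb : ∀ x, ‖f x‖ ≤ 1 := fun x => abs_profile_le_one _ _
  have ie := (memLp_inner_stdGaussian e).integrable_sq
  have iw := (memLp_inner_stdGaussian w).integrable_sq
  have iew := (memLp_inner_stdGaussian e).integrable_mul (memLp_inner_stdGaussian w)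
  have hfae : AEStronglyMeasurable (fun b : E => f (inner ℝ b e)) (stdGaussian E) :=
    (hfm.comp (by fun_prop)).aestronglyMeasurable
  have j1 : Integrable (fun b : E => f (inner ℝ b e) * inner ℝ b e ^ 2) (stdGaussian E) :=
    ie.bdd_mul hfae (ae_of_all _ fun b => hb _)
  have j2 : Integrable (fun b : E => f (inner ℝ b e) * inner ℝ b w ^ 2) (stdGaussian E) :=
    iw.bdd_mul hfae (ae_of_all _ fun b => hb _)
  have j3 : Integrable (fun b : E => (f (inner ℝ b e) * inner ℝ b e) * inner ℝ b w)
      (stdGaussian E) := by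
    refine (iew.bdd_mul hfae (ae_of_all _ fun b => hb _)).congr (ae_of_all _ fun b => ?_)
    simp [mul_assoc]
  have hexp : ∀ b : E, profile α β s (inner ℝ b e ^ 2) * inner ℝ b u ^ 2
      = q ^ 2 * (f (inner ℝ b e) * inner ℝ b e ^ 2)
        + 2 * q * ((f (inner ℝ b e) * inner ℝ b e) * inner ℝ b w)
        + f (inner ℝ b e) * inner ℝ b w ^ 2 := by
    intro b
    have : inner ℝ b u = q * inner ℝ b e + inner ℝ b w := by
      rw [hw, inner_sub_right, inner_smul_right]; ring
    rw [this]
    ring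
  simp only [hexp]
  have k1 := integral_add ((j1.const_mul (q ^ 2)).add (j3.const_mul (2 * q))) j2
  have k2 := integral_add (j1.const_mul (q ^ 2)) (j3.const_mul (2 * q))
  simp only [Pi.add_apply] at k1
  rw [k1, k2, integral_const_mul, integral_const_mul, hcross, hsq, hM1, hnw]
  ring

theorem gaussianReal_Icc_le (s : ℝ) :
    gaussianReal 0 1 (Set.Icc (-s) s) ≤ ENNReal.ofReal (2 * s) := by
  rw [gaussianReal_apply _ one_ne_zero]
  calc ∫⁻ x in Set.Icc (-s) s, gaussianPDF 0 1 x ≤ ∫⁻ _ in Set.Icc (-s) s, 1 := by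
        refine lintegral_mono fun x => ?_
        rw [gaussianPDF, ← ENNReal.ofReal_one]
        apply ENNReal.ofReal_le_ofReal
        rw [gaussianPDFReal]
        refine mul_le_one₀ (inv_le_one_of_one_le₀ ?_) (Real.exp_pos _).le
          (Real.exp_le_one_iff.2 ?_)
        · rw [Real.one_le_sqrt]
          simp
          linarith [Real.pi_gt_three]
        · rw [neg_div, neg_nonpos]
          positivity
    _ = ENNReal.ofReal (2 * s) := by
        rw [setLIntegral_one, Real.volume_Icc]
        congr 1
        ring

/-- A standard Gaussian vector has non-negligible overlap with any fixed direction, uniformly in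
the direction. -/
theorem exists_overlap (E : Type*) [NormedAddCommGroup E] [InnerProductSpace ℝ E]
    [FiniteDimensional ℝ E] [MeasurableSpace E] [BorelSpace E] {κ : ℝ} (hκ : 0 < κ) :
    ∃ ε : ℝ, 0 < ε ∧ ∀ v : E, ‖v‖ = 1 →
      stdGaussian E {g | ¬ (g ≠ 0 ∧ ε * ‖g‖ ≤ |inner ℝ v g|)} ≤ ENNReal.ofReal κ := by
  have hint : Integrable (fun g : E => ‖g‖) (stdGaussian E) := IsGaussian.integrable_id.norm
  set I := ∫ g, ‖g‖ ∂stdGaussian E with hI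
  have hI0 : 0 ≤ I := integral_nonneg fun g => norm_nonneg g
  -- Markov's inequality at this radius costs `κ / 2`; the slab of half-width `κ / 4` around the
  -- hyperplane `v⊥` costs the other half.
  set R := 2 * (I + 1) / κ with hR
  have hR0 : 0 < R := by positivity
  refine ⟨κ / (4 * R), by positivity, fun v hv => ?_⟩
  set s := κ / 4 with hs
  have h1 : stdGaussian E {g | R ≤ ‖g‖} ≤ ENNReal.ofReal (κ / 2) := by
    have h := mul_meas_ge_le_integral_of_nonneg (ae_of_all _ fun g : E => norm_nonneg g) hint R
    rw [← ofReal_measureReal]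
    apply ENNReal.ofReal_le_ofReal
    have h2 : (stdGaussian E).real {g | R ≤ ‖g‖} ≤ I / R := by
      rw [le_div_iff₀ hR0, mul_comm]; exact h
    refine h2.trans ?_
    rw [hR, div_div_eq_mul_div, div_le_div_iff₀ (by positivity) (by positivity)]
    nlinarith
  have h2 : stdGaussian E {g | inner ℝ g v ∈ Set.Icc (-s) s} ≤ ENNReal.ofReal (κ / 2) := by
    rw [(hasLaw_inner_stdGaussian hv).measure_eq (p := fun z => z ∈ Set.Icc (-s) s)
      measurableSet_Icc]
    refine (gaussianReal_Icc_le s).trans (le_of_eq ?_)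
    congr 1
    rw [hs]; ring
  have hsub : {g : E | ¬ (g ≠ 0 ∧ κ / (4 * R) * ‖g‖ ≤ |inner ℝ v g|)}
      ⊆ {g | R ≤ ‖g‖} ∪ {g | inner ℝ g v ∈ Set.Icc (-s) s} := by
    intro g hg
    by_cases hgR : R ≤ ‖g‖
    · exact Or.inl hgR
    right
    have hgR := not_le.1 hgR
    change inner ℝ g v ∈ Set.Icc (-s) s
    rw [Set.mem_Icc, ← abs_le]
    by_cases hg0 : g = 0
    · simp [hg0, hs]; positivity
    · have h3 : |inner ℝ v g| < κ / (4 * R) * ‖g‖ := by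
        by_contra! hc
        exact hg ⟨hg0, hc⟩
      rw [real_inner_comm]
      refine h3.le.trans ?_
      calc κ / (4 * R) * ‖g‖ ≤ κ / (4 * R) * R := by gcongr
        _ = s := by rw [hs]; field_simp
  refine (measure_mono hsub).trans ((measure_union_le _ _).trans ((add_le_add h1 h2).trans ?_))
  rw [← ENNReal.ofReal_add (by positivity) (by positivity)]
  simp

end Marginals

/-! ### Well-spread samples are overwhelmingly likely -/

section Sample

variable {n m : ℕ} {α β : ℝ}

/-- The law of `m` independent standard Gaussian vectors in `ℝⁿ`. -/
abbrev sampleLaw (n m : ℕ) : Measure (Fin m → EuclideanSpace ℝ (Fin n)) :=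
  Measure.pi fun _ => stdGaussian (EuclideanSpace ℝ (Fin n))

theorem hasLaw_eval_sampleLaw (i : Fin m) :
    HasLaw (fun a : Fin m → EuclideanSpace ℝ (Fin n) => a i)
      (stdGaussian (EuclideanSpace ℝ (Fin n))) (sampleLaw n m) :=
  (measurePreserving_eval (fun _ : Fin m => stdGaussian (EuclideanSpace ℝ (Fin n))) i).hasLaw

theorem iIndepFun_sampleLaw {f : EuclideanSpace ℝ (Fin n) → ℝ} (hf : Measurable f) :
    iIndepFun (fun (i : Fin m) (a : Fin m → EuclideanSpace ℝ (Fin n)) => f (a i))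
      (sampleLaw n m) :=
  iIndepFun_pi (X := fun _ => f) fun _ => hf.aemeasurable

theorem integral_eval_sampleLaw {f : EuclideanSpace ℝ (Fin n) → ℝ} (hf : Measurable f)
    (i : Fin m) : ∫ a, f (a i) ∂sampleLaw n m
      = ∫ b, f b ∂stdGaussian (EuclideanSpace ℝ (Fin n)) :=
  (hasLaw_eval_sampleLaw i).integral_comp hf.aestronglyMeasurable

theorem measure_average_ge_le {f : EuclideanSpace ℝ (Fin n) → ℝ} (hf : Measurable f)
    {u : EuclideanSpace ℝ (Fin n)} (hu : ‖u‖ = 1) (h0 : ∀ b, 0 ≤ f b)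
    (h1 : ∀ b, f b ≤ inner ℝ b u ^ 2) {η : ℝ} (hη : 0 < η) :
    (sampleLaw n m).real {a | m * (∫ b, f b ∂stdGaussian (EuclideanSpace ℝ (Fin n)) + η)
      ≤ ∑ i, f (a i)} ≤ Real.exp (-(rate η * m)) := by
  have hG : ∀ i : Fin m, HasLaw (fun a : Fin m → EuclideanSpace ℝ (Fin n) => inner ℝ (a i) u)
      (gaussianReal 0 1) (sampleLaw n m) :=
    fun i => (hasLaw_inner_stdGaussian hu).fun_comp (hasLaw_eval_sampleLaw i)
  have hX : ∀ i : Fin m, Measurable fun a : Fin m → EuclideanSpace ℝ (Fin n) => f (a i) :=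
    fun i => by fun_prop
  exact measure_sum_ge_le hη (iIndepFun_sampleLaw hf) hG hX (fun _ _ => h0 _) (fun _ _ => h1 _)
    (integral_eval_sampleLaw hf)

theorem measure_average_le_le {f : EuclideanSpace ℝ (Fin n) → ℝ} (hf : Measurable f)
    {u : EuclideanSpace ℝ (Fin n)} (hu : ‖u‖ = 1) (h0 : ∀ b, 0 ≤ f b)
    (h1 : ∀ b, f b ≤ inner ℝ b u ^ 2) {η : ℝ} (hη : 0 < η) :
    (sampleLaw n m).real {a | ∑ i, f (a i)
      ≤ m * (∫ b, f b ∂stdGaussian (EuclideanSpace ℝ (Fin n)) - η)} ≤ Real.exp (-(rate η * m)) := by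
  have hG : ∀ i : Fin m, HasLaw (fun a : Fin m → EuclideanSpace ℝ (Fin n) => inner ℝ (a i) u)
      (gaussianReal 0 1) (sampleLaw n m) :=
    fun i => (hasLaw_inner_stdGaussian hu).fun_comp (hasLaw_eval_sampleLaw i)
  have hX : ∀ i : Fin m, Measurable fun a : Fin m → EuclideanSpace ℝ (Fin n) => f (a i) :=
    fun i => by fun_prop
  exact measure_sum_le_le hη (iIndepFun_sampleLaw hf) hG hX (fun _ _ => h0 _) (fun _ _ => h1 _)
    (integral_eval_sampleLaw hf)

/-- The contribution of a sample vector `b` to the quadratic form at `u`, at scale `s`. -/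
def contrib (α β s : ℝ) (e u b : EuclideanSpace ℝ (Fin n)) : ℝ :=
  profile α β s (inner ℝ b e ^ 2) * inner ℝ b u ^ 2

theorem measurable_contrib (s : ℝ) (e u : EuclideanSpace ℝ (Fin n)) :
    Measurable (contrib α β s e u) := by
  unfold contrib
  exact ((measurable_profile s).comp (by fun_prop)).mul (by fun_prop)

theorem contrib_nonneg (hα : 0 < α) {s : ℝ} (hs : 0 ≤ s) (e u b : EuclideanSpace ℝ (Fin n)) :
    0 ≤ contrib α β s e u b :=
  mul_nonneg (profile_nonneg hα hs (sq_nonneg _)) (sq_nonneg _)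

theorem contrib_le (s : ℝ) (e u b : EuclideanSpace ℝ (Fin n)) :
    contrib α β s e u b ≤ inner ℝ b u ^ 2 :=
  mul_le_of_le_one_left (sq_nonneg _) (profile_le_one _ _)

theorem intensity_eq {x e : EuclideanSpace ℝ (Fin n)} (hx : x = ‖x‖ • e)
    (a : Fin m → EuclideanSpace ℝ (Fin n)) (i : Fin m) :
    intensity a x i = ‖x‖ ^ 2 * inner ℝ (a i) e ^ 2 := by
  conv_lhs => rw [intensity, hx, inner_smul_right, sq_abs, mul_pow]

theorem sampleMean_intensity_eq {x e : EuclideanSpace ℝ (Fin n)} (hx : x = ‖x‖ • e)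
    (a : Fin m → EuclideanSpace ℝ (Fin n)) :
    sampleMean (intensity a x) = ‖x‖ ^ 2 * (1 / m * ∑ i, inner ℝ (a i) e ^ 2) := by
  simp only [sampleMean, intensity_eq hx, ← Finset.mul_sum]
  ring

theorem rayleigh_eq_contrib {x e : EuclideanSpace ℝ (Fin n)} (hx : x = ‖x‖ • e) (hx0 : x ≠ 0)
    (a : Fin m → EuclideanSpace ℝ (Fin n)) (u : EuclideanSpace ℝ (Fin n)) :
    rayleigh α β a (intensity a x) u
      = 1 / m * ∑ i, contrib α β (1 / m * ∑ j, inner ℝ (a j) e ^ 2) e u (a i) := by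
  have : 0 < ‖x‖ ^ 2 := by have := norm_pos_iff.2 hx0; positivity
  simp only [rayleigh, weight_eq_profile, sampleMean_intensity_eq hx, intensity_eq hx,
    profile_smul this, contrib]

theorem contrib_antitone (hα : 0 < α) (hβ : 0 ≤ β) {s s' : ℝ} (hs : 0 < s) (h : s ≤ s')
    (e u b : EuclideanSpace ℝ (Fin n)) : contrib α β s' e u b ≤ contrib α β s e u b :=
  mul_le_mul_of_nonneg_right (profile_antitone hα hβ hs h (sq_nonneg _)) (sq_nonneg _)

/-- The linear map whose squared norm is the quadratic form at scale `s`. -/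
theorem exists_linear_contrib (hα : 0 < α) {s : ℝ} (hs : 0 ≤ s) (e : EuclideanSpace ℝ (Fin n))
    (a : Fin m → EuclideanSpace ℝ (Fin n)) :
    ∃ A : EuclideanSpace ℝ (Fin n) →L[ℝ] EuclideanSpace ℝ (Fin m),
      ∀ u, ‖A u‖ ^ 2 = 1 / m * ∑ i, contrib α β s e u (a i) := by
  let w : Fin m → ℝ := fun i => 1 / m * profile α β s (inner ℝ (a i) e ^ 2)
  have hw : ∀ i, 0 ≤ w i := fun i =>
    mul_nonneg (by positivity) (profile_nonneg hα hs (sq_nonneg _))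
  refine ⟨(EuclideanSpace.equiv (Fin m) ℝ).symm.toContinuousLinearMap.comp
    (ContinuousLinearMap.pi fun i => Real.sqrt (w i) • innerSL ℝ (a i)), fun u => ?_⟩
  rw [EuclideanSpace.real_norm_sq_eq, Finset.mul_sum]
  refine Finset.sum_congr rfl fun i _ => ?_
  simp only [ContinuousLinearMap.comp_apply, ContinuousLinearEquiv.coe_coe,
    PiLp.coe_symm_continuousLinearEquiv, ContinuousLinearMap.pi_apply,
    smul_apply, innerSL_apply_apply, smul_eq_mul, mul_pow, Real.sq_sqrt (hw i)]
  simp only [w, contrib]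
  ring

/-- Monotonicity in the scale reduces the upper bound to scale `1 - τ` and the lower bound to `1 +
τ`. In the upper bound, `η / 2` is spent at the net points and `η / 2` on passing from the net to
the sphere. -/
theorem wellSpread_of_average_bounds (hα : 0 < α) (hβ : 0 ≤ β) (hm : m ≠ 0)
    {x e : EuclideanSpace ℝ (Fin n)} (hx : x = ‖x‖ • e) (hx0 : x ≠ 0) (he : ‖e‖ = 1)
    {p r η τ ε : ℝ} (hp : 0 ≤ p) (hpr : p ≤ r) (hη : 0 < η) (hτ1 : τ < 1)
    (hε0 : 0 < ε) (hε : ε ≤ 1 / 2) (hε' : 20 * (r + η) * ε ≤ η)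
    {N : Set (EuclideanSpace ℝ (Fin n))} (hN1 : ∀ c ∈ N, ‖c‖ = 1)
    (hN : ∀ v : EuclideanSpace ℝ (Fin n), ‖v‖ = 1 → ∃ c ∈ N, ‖v - c‖ < ε)
    {a : Fin m → EuclideanSpace ℝ (Fin n)}
    (h1 : ∑ i, inner ℝ (a i) e ^ 2 ≤ m * (1 + τ)) (h2 : m * (1 - τ) ≤ ∑ i, inner ℝ (a i) e ^ 2)
    (h3 : m * (r - η) ≤ ∑ i, contrib α β (1 + τ) e e (a i))
    (h4 : ∀ c ∈ N, ∑ i, contrib α β (1 - τ) e c (a i)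
      ≤ m * (p + (r - p) * inner ℝ c e ^ 2 + η / 2)) :
    WellSpread α β p r η τ x e a := by
  have hm0 : (0 : ℝ) < m := by exact_mod_cast Nat.pos_of_ne_zero hm
  set s : ℝ := 1 / m * ∑ i, inner ℝ (a i) e ^ 2 with hs
  have hs1 : s ≤ 1 + τ := by
    rw [hs, one_div, inv_mul_le_iff₀ hm0]; exact h1
  have hs2 : 1 - τ ≤ s := by
    rw [hs, one_div, le_inv_mul_iff₀ hm0]; exact h2
  have hs0 : 0 < s := by linarith
  refine ⟨?_, fun u hu => ?_, ?_⟩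
  · rw [sampleMean_intensity_eq hx, ← hs, show ‖x‖ ^ 2 * s - ‖x‖ ^ 2 = (s - 1) * ‖x‖ ^ 2 by ring,
      abs_mul, abs_of_nonneg (sq_nonneg ‖x‖)]
    gcongr
    exact abs_le.2 ⟨by linarith, by linarith⟩
  · obtain ⟨A, hA⟩ := exists_linear_contrib (α := α) (β := β) hα (by linarith : 0 ≤ 1 - τ) e a
    have h5 := norm_sq_le_of_net A he hε0 hε hp hpr (by positivity : 0 ≤ η / 2) hN1 hN
      (fun c hc => by
        rw [hA, one_div, inv_mul_le_iff₀ hm0]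
        exact h4 c hc) hu
    rw [hA] at h5
    rw [rayleigh_eq_contrib hx hx0, ← hs]
    have h6 : 1 / (m : ℝ) * ∑ i, contrib α β s e u (a i)
        ≤ 1 / m * ∑ i, contrib α β (1 - τ) e u (a i) := by
      gcongr with i
      exact contrib_antitone hα hβ (by linarith) hs2 _ _ _
    nlinarith
  · rw [rayleigh_eq_contrib hx hx0, ← hs]
    calc r - η ≤ 1 / m * ∑ i, contrib α β (1 + τ) e e (a i) := by
          rw [one_div, le_inv_mul_iff₀ hm0]; exact h3
      _ ≤ 1 / m * ∑ i, contrib α β s e e (a i) := by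
          gcongr with i
          exact contrib_antitone hα hβ hs0 hs1 _ _ _

theorem integral_contrib {e u : EuclideanSpace ℝ (Fin n)} (he : ‖e‖ = 1) (hu : ‖u‖ = 1) (s : ℝ) :
    ∫ b, contrib α β s e u b ∂stdGaussian (EuclideanSpace ℝ (Fin n))
      = profileMoment α β s 0
        + (profileMoment α β s 1 - profileMoment α β s 0) * inner ℝ u e ^ 2 :=
  integral_profile_mul_sq_inner he hu s

/-- The union bound over all exceptional events. -/
theorem measure_not_wellSpread_le (hα : 0 < α) (hβ : 0 ≤ β) (hm : m ≠ 0)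
    {x e : EuclideanSpace ℝ (Fin n)} (hx : x = ‖x‖ • e) (hx0 : x ≠ 0) (he : ‖e‖ = 1)
    {p r η τ ε κ : ℝ} (hp : 0 ≤ p) (hpr : p ≤ r) (hη : 0 < η) (hτ : 0 < τ) (hτ1 : τ < 1)
    (hε0 : 0 < ε) (hε : ε ≤ 1 / 2) (hε' : 20 * (r + η) * ε ≤ η)
    (hp' : profileMoment α β (1 - τ) 0 ≤ p + η / 4)
    (hr' : profileMoment α β (1 - τ) 1 ≤ r + η / 4)
    (hr'' : r - η / 2 ≤ profileMoment α β (1 + τ) 1)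
    (hκ1 : κ ≤ rate τ) (hκ2 : κ ≤ rate (η / 2)) (hκ3 : κ ≤ rate (η / 4)) :
    (sampleLaw n m).real {a | ¬ WellSpread α β p r η τ x e a}
      ≤ 4 * ((1 + 2 / ε) ^ n * Real.exp (-(κ * m))) := by
  obtain ⟨N, hN1, hNcard, hN⟩ := exists_sphere_net (E := EuclideanSpace ℝ (Fin n)) hε0
  rw [finrank_euclideanSpace_fin] at hNcard
  set P := sampleLaw n m
  let B1 : Set (Fin m → EuclideanSpace ℝ (Fin n)) := {a | m * (1 + τ) ≤ ∑ i, inner ℝ (a i) e ^ 2}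
  let B2 : Set (Fin m → EuclideanSpace ℝ (Fin n)) := {a | ∑ i, inner ℝ (a i) e ^ 2 ≤ m * (1 - τ)}
  let B3 : Set (Fin m → EuclideanSpace ℝ (Fin n)) :=
    {a | ∑ i, contrib α β (1 + τ) e e (a i) ≤ m * (profileMoment α β (1 + τ) 1 - η / 2)}
  let B4 : EuclideanSpace ℝ (Fin n) → Set (Fin m → EuclideanSpace ℝ (Fin n)) := fun c =>
    {a | m * (∫ b, contrib α β (1 - τ) e c b ∂stdGaussian (EuclideanSpace ℝ (Fin n)) + η / 4)
      ≤ ∑ i, contrib α β (1 - τ) e c (a i)}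
  have hexp : ∀ κ', κ ≤ κ' → Real.exp (-(κ' * m)) ≤ Real.exp (-(κ * m)) := fun κ' h => by
    apply Real.exp_le_exp.2
    gcongr
  have hsq : ∫ b, inner ℝ b e ^ 2 ∂stdGaussian (EuclideanSpace ℝ (Fin n)) = 1 := by
    rw [integral_sq_inner_stdGaussian, he]; norm_num
  have b1 : P.real B1 ≤ Real.exp (-(κ * m)) := by
    have := measure_average_ge_le (m := m) (f := fun b => inner ℝ b e ^ 2) (by fun_prop) he
      (fun b => sq_nonneg _) (fun b => le_rfl) hτ
    rw [hsq] at this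
    exact this.trans (hexp _ hκ1)
  have b2 : P.real B2 ≤ Real.exp (-(κ * m)) := by
    have := measure_average_le_le (m := m) (f := fun b => inner ℝ b e ^ 2) (by fun_prop) he
      (fun b => sq_nonneg _) (fun b => le_rfl) hτ
    rw [hsq] at this
    exact this.trans (hexp _ hκ1)
  have b3 : P.real B3 ≤ Real.exp (-(κ * m)) := by
    have := measure_average_le_le (m := m) (measurable_contrib (α := α) (β := β) (1 + τ) e e) he
      (contrib_nonneg hα (by linarith) e e) (contrib_le _ e e) (half_pos hη)
    rw [integral_contrib he he, real_inner_self_eq_norm_sq, he] at this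
    refine le_trans (le_of_eq ?_) (this.trans (hexp _ hκ2))
    congr 1
    simp only [B3]
    congr! 5
    ring
  have b4 : ∀ c ∈ N, P.real (B4 c) ≤ Real.exp (-(κ * m)) := fun c hc =>
    (measure_average_ge_le (m := m) (measurable_contrib (α := α) (β := β) (1 - τ) e c) (hN1 c hc)
      (contrib_nonneg hα (by linarith) e c) (contrib_le _ e c) (by positivity)).trans (hexp _ hκ3)
  have hsub : {a | ¬ WellSpread α β p r η τ x e a} ⊆ B1 ∪ B2 ∪ B3 ∪ ⋃ c ∈ N, B4 c := by
    intro a ha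
    by_contra hc
    simp only [Set.mem_union, Set.mem_iUnion, not_or, not_exists] at hc
    obtain ⟨⟨⟨c1, c2⟩, c3⟩, c4⟩ := hc
    simp only [B1, B2, B3, B4, Set.mem_ofPred_eq, not_le] at c1 c2 c3 c4
    refine ha (wellSpread_of_average_bounds hα hβ hm hx hx0 he hp hpr hη hτ1 hε0 hε hε'
      (N := (N : Set _)) (fun c hc => hN1 c hc) (fun v hv => hN v hv) c1.le c2.le ?_ fun c hc => ?_)
    · exact (mul_le_mul_of_nonneg_left (by linarith) (Nat.cast_nonneg m)).trans c3.le
    · refine (c4 c hc).le.trans ?_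
      rw [integral_contrib he (hN1 c hc)]
      have h1 := abs_real_inner_le_norm c e
      rw [he, hN1 c hc, mul_one, ← sq_le_one_iff_abs_le_one] at h1
      refine mul_le_mul_of_nonneg_left ?_ (Nat.cast_nonneg m)
      -- The mean is a convex combination of the two moments with weights `1 - ⟨c, e⟩²` and `⟨c,
      -- e⟩²`, so moment errors of `η / 4` are not amplified.
      nlinarith [sq_nonneg (inner ℝ c e : ℝ),
        mul_le_mul_of_nonneg_right hr' (sq_nonneg (inner ℝ c e : ℝ)),
        mul_le_mul_of_nonneg_right hp' (sub_nonneg.2 h1)]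
  have hM : 1 ≤ (1 + 2 / ε) ^ n := one_le_pow₀ (by have : 0 < 2 / ε := by positivity
                                                   linarith)
  have b5 : P.real (⋃ c ∈ N, B4 c) ≤ (1 + 2 / ε) ^ n * Real.exp (-(κ * m)) := by
    calc P.real (⋃ c ∈ N, B4 c) ≤ ∑ c ∈ N, P.real (B4 c) := measureReal_biUnion_finset_le _ _
      _ ≤ ∑ c ∈ N, Real.exp (-(κ * m)) := Finset.sum_le_sum b4
      _ = N.card * Real.exp (-(κ * m)) := by rw [Finset.sum_const, nsmul_eq_mul]
      _ ≤ _ := by gcongr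
  have b6 : Real.exp (-(κ * m)) ≤ (1 + 2 / ε) ^ n * Real.exp (-(κ * m)) :=
    le_mul_of_one_le_left (Real.exp_pos _).le hM
  calc P.real {a | ¬ WellSpread α β p r η τ x e a}
      ≤ P.real (B1 ∪ B2 ∪ B3 ∪ ⋃ c ∈ N, B4 c) := measureReal_mono hsub
    _ ≤ P.real B1 + P.real B2 + P.real B3 + P.real (⋃ c ∈ N, B4 c) := by
        have u1 := measureReal_union_le (μ := P) (B1 ∪ B2 ∪ B3) (⋃ c ∈ N, B4 c)
        have u2 := measureReal_union_le (μ := P) (B1 ∪ B2) B3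
        have u3 := measureReal_union_le (μ := P) B1 B2
        linarith
    _ ≤ _ := by linarith

/-- With `m > c₀ n` samples, failure to be well spread has exponentially small probability. -/
theorem exists_rate_not_wellSpread (hα : 0 < α) (hβ : 0 ≤ β) {η τ₀ : ℝ} (hη : 0 < η)
    (hτ₀ : 0 < τ₀) :
    ∃ c c₀ τ : ℝ, 0 < c ∧ 0 < c₀ ∧ 0 < τ ∧ τ ≤ τ₀ ∧ ∀ n m : ℕ, c₀ * (n : ℝ) < (m : ℝ) →
      ∀ x e : EuclideanSpace ℝ (Fin n), x = ‖x‖ • e → x ≠ 0 → ‖e‖ = 1 →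
      (sampleLaw n m).real {a | ¬ WellSpread α β (profileMoment α β 1 0)
        (profileMoment α β 1 1) η τ x e a} ≤ 1 / 2 * Real.exp (-c * m) := by
  set p := profileMoment α β 1 0
  set r := profileMoment α β 1 1
  have hp : 0 ≤ p := profileMoment_nonneg hα zero_le_one 0
  have hpr : p < r := profileMoment_gap hα hβ
  have hcont (k : ℕ) : ∃ d > 0, ∀ s : ℝ, |s - 1| < d →
      |profileMoment α β s k - profileMoment α β 1 k| < η / 4 := by
    obtain ⟨d, hd, h⟩ := Metric.continuousAt_iff.1 (continuousAt_profileMoment (β := β) hα k)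
      (η / 4) (by positivity)
    exact ⟨d, hd, fun s hs => h (by rwa [Real.dist_eq])⟩
  obtain ⟨d0, hd0, hc0⟩ := hcont 0
  obtain ⟨d1, hd1, hc1⟩ := hcont 1
  set τ := min τ₀ (min (1 / 2) (min (d0 / 2) (d1 / 2))) with hτ
  have hτpos : 0 < τ := by positivity
  have hτa : τ ≤ 1 / 2 := (min_le_right _ _).trans (min_le_left _ _)
  have hτb : τ ≤ d0 / 2 := (min_le_right _ _).trans ((min_le_right _ _).trans (min_le_left _ _))
  have hτc : τ ≤ d1 / 2 := (min_le_right _ _).trans ((min_le_right _ _).trans (min_le_right _ _))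
  have am : |(1 - τ) - 1| = τ := by rw [sub_sub_cancel_left, abs_neg, abs_of_pos hτpos]
  have ap : |(1 + τ) - 1| = τ := by rw [add_sub_cancel_left, abs_of_pos hτpos]
  have e1 := abs_lt.1 (hc0 (1 - τ) (by rw [am]; linarith))
  have e2 := abs_lt.1 (hc1 (1 - τ) (by rw [am]; linarith))
  have e3 := abs_lt.1 (hc1 (1 + τ) (by rw [ap]; linarith))
  set ε := min (1 / 2) (η / (20 * (r + η))) with hε
  have hrη : 0 < r + η := by linarith
  have hε0 : 0 < ε := by positivity
  have hε' : 20 * (r + η) * ε ≤ η := by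
    have : ε ≤ η / (20 * (r + η)) := min_le_right _ _
    rw [le_div_iff₀ (by positivity)] at this
    linarith
  set κ := min (rate τ) (min (rate (η / 2)) (rate (η / 4))) with hκ
  have hκ0 : 0 < κ :=
    lt_min (rate_pos hτpos) (lt_min (rate_pos (by positivity)) (rate_pos (by positivity)))
  set M := 1 + 2 / ε with hM
  have hM1 : 1 < M := by have : 0 < 2 / ε := by positivity
                         linarith
  have hlM : 0 < Real.log M := Real.log_pos hM1
  have hl8 : 0 < Real.log 8 := Real.log_pos (by norm_num)
  -- Half of the exponent `κ m` pays for the net cardinality `M ^ n` and the factor 8. As `n ≥ 1`,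
  -- the constant `log 8` is absorbed into the multiple of `n`.
  refine ⟨κ / 2, 2 * (Real.log 8 + Real.log M) / κ, τ, by positivity, by positivity, hτpos,
    min_le_left _ _, fun n m hnm x e hx hx0 he => ?_⟩
  have hn : n ≠ 0 := by
    rintro rfl
    exact hx0 (Subsingleton.elim _ _)
  have hn1 : (1 : ℝ) ≤ n := by exact_mod_cast Nat.one_le_iff_ne_zero.2 hn
  have hm : m ≠ 0 := by
    rintro rfl
    have : 0 ≤ 2 * (Real.log 8 + Real.log M) / κ * (n : ℝ) := by positivity
    simp only [Nat.cast_zero] at hnm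
    linarith
  refine (measure_not_wellSpread_le hα hβ hm hx hx0 he hp hpr.le hη hτpos (by linarith) hε0
    (min_le_left _ _) hε' (by linarith [e1.2]) (by linarith [e2.2]) (by linarith [e3.1])
    (min_le_left _ _) ((min_le_right _ _).trans (min_le_left _ _))
    ((min_le_right _ _).trans (min_le_right _ _))).trans ?_
  rw [div_mul_eq_mul_div, div_lt_iff₀ hκ0] at hnm
  have h8 : 8 * (M ^ n * Real.exp (-(κ * m))) ≤ Real.exp (-(κ / 2) * m) := by
    rw [← Real.exp_log (by norm_num : (0 : ℝ) < 8), ← Real.exp_log (by positivity : 0 < M),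
      ← Real.exp_nat_mul, ← Real.exp_add, ← Real.exp_add]
    apply Real.exp_le_exp.2
    nlinarith
  linarith

end Sample

/-! ### Transfer to arbitrary probability spaces -/

section Transfer

variable {n m : ℕ} {α β : ℝ}

theorem measurable_weightedCov {Z : Type*} [MeasurableSpace Z]
    {A : Z → Fin m → EuclideanSpace ℝ (Fin n)} {V : Z → EuclideanSpace ℝ (Fin n)}
    (hA : ∀ i, Measurable fun z => A z i) (hV : Measurable V) (x : EuclideanSpace ℝ (Fin n)) :
    Measurable fun z => weightedCov α β (A z) (intensity (A z) x) (V z) := by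
  have hI : ∀ i, Measurable fun z => intensity (A z) x i := fun i => by
    simp only [intensity, sq_abs]
    fun_prop
  have hS : Measurable fun z => sampleMean (intensity (A z) x) := by
    unfold sampleMean
    fun_prop
  have hW : ∀ i, Measurable fun z => weight α β (intensity (A z) x) i := fun i => by
    simp only [weight_eq_profile]
    exact measurable_profile_uncurry.comp (hS.prodMk (hI i))
  unfold weightedCov
  fun_prop

theorem measurable_powerIterate (x : EuclideanSpace ℝ (Fin n)) (t : ℕ) :
    Measurable fun q : EuclideanSpace ℝ (Fin n) × (Fin m → EuclideanSpace ℝ (Fin n)) =>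
      powerIterate α β q.2 (intensity q.2 x) q.1 t := by
  induction t with
  | zero =>
    simp only [powerIterate]
    fun_prop
  | succ t ih =>
    simp only [powerIterate]
    have := measurable_weightedCov (α := α) (β := β)
      (A := fun q : EuclideanSpace ℝ (Fin n) × (Fin m → EuclideanSpace ℝ (Fin n)) => q.2)
      (fun i => by fun_prop) ih x
    fun_prop

/-- Computing the product measure of the failure event by sections requires that event to be
measurable. -/
theorem measurable_signDist_powerIterate (x : EuclideanSpace ℝ (Fin n)) (t : ℕ) :
    Measurable fun q : EuclideanSpace ℝ (Fin n) × (Fin m → EuclideanSpace ℝ (Fin n)) =>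
      signDist (rescale (intensity q.2 x) (powerIterate α β q.2 (intensity q.2 x) q.1 t)) x := by
  have h := measurable_powerIterate (α := α) (β := β) (m := m) x t
  unfold signDist rescale sampleMean
  simp only [intensity, sq_abs] at h ⊢
  fun_prop

variable {Ω : Type*} [MeasurableSpace Ω] {μ : Measure Ω} [IsProbabilityMeasure μ]

/-- Subadditivity suffices, so `A` need not be measurable; this matters for the event quantifying
over all leading eigenvectors. -/
theorem one_sub_le_measureReal {Z : Type*} [MeasurableSpace Z] {ν : Measure Z} {Y : Ω → Z}
    (hY : HasLaw Y ν μ) {A : Set Ω} {B : Set Z} (hAB : ∀ ω, ω ∉ A → Y ω ∈ B) {b : ℝ}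
    (hb : 0 ≤ b) (hB : ν B ≤ ENNReal.ofReal b) : 1 - b ≤ μ.real A := by
  have h1 : μ Aᶜ ≤ ENNReal.ofReal b := by
    calc μ Aᶜ ≤ μ (Y ⁻¹' B) := measure_mono hAB
      _ ≤ μ.map Y B := Measure.le_map_apply hY.aemeasurable B
      _ ≤ _ := by rw [hY.map_eq]; exact hB
  have h2 : μ.real Aᶜ ≤ b := ENNReal.toReal_le_of_le_ofReal hb h1
  have h3 := measureReal_union_le (μ := μ) A Aᶜ
  rw [Set.union_compl_self, probReal_univ] at h3
  linarith

theorem hasLaw_sample {a : Fin m → Ω → EuclideanSpace ℝ (Fin n)}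
    (ha : ∀ i, HasLaw (a i) (stdGaussian (EuclideanSpace ℝ (Fin n))) μ) (hind : iIndepFun a μ) :
    HasLaw (fun ω i => a i ω) (sampleLaw n m) μ where
  aemeasurable := aemeasurable_pi_lambda _ fun i => (ha i).aemeasurable
  map_eq := by
    rw [(iIndepFun_iff_map_fun_eq_pi_map fun i => (ha i).aemeasurable).1 hind]
    simp only [(ha _).map_eq]

theorem hasLaw_start_sample {a : Fin m → Ω → EuclideanSpace ℝ (Fin n)}
    {g : Ω → EuclideanSpace ℝ (Fin n)}
    (ha : HasLaw (fun ω i => a i ω) (sampleLaw n m) μ)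
    (hg : HasLaw g (stdGaussian (EuclideanSpace ℝ (Fin n))) μ)
    (hind : IndepFun g (fun ω i => a i ω) μ) :
    HasLaw (fun ω => (g ω, fun i => a i ω))
      ((stdGaussian (EuclideanSpace ℝ (Fin n))).prod (sampleLaw n m)) μ where
  aemeasurable := hg.aemeasurable.prodMk ha.aemeasurable
  map_eq := by
    rw [(indepFun_iff_map_prod_eq_prod_map_map hg.aemeasurable ha.aemeasurable).1 hind,
      hg.map_eq, ha.map_eq]

/-- A bound on a product measure from a bound on the sections outside a small set. -/
theorem prod_measure_le_of_sections {X Y : Type*} [MeasurableSpace X] [MeasurableSpace Y]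
    {ν : Measure X} {P : Measure Y} [SFinite ν] [IsProbabilityMeasure P] [IsProbabilityMeasure ν]
    {S : Set (X × Y)} (hS : MeasurableSet S) {H : Set Y} {a b : ENNReal} (hH : P H ≤ a)
    (hsec : ∀ y, y ∉ H → ν {x | (x, y) ∈ S} ≤ b) : ν.prod P S ≤ a + b := by
  -- `H` need not be measurable; its measurable hull has the same measure.
  set K := toMeasurable P H with hK
  rw [Measure.prod_apply_symm hS]
  calc ∫⁻ y, ν ((fun x => (x, y)) ⁻¹' S) ∂P ≤ ∫⁻ y, (K.indicator 1 y + b) ∂P := by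
        refine lintegral_mono fun y => ?_
        by_cases hy : y ∈ K
        · rw [Set.indicator_of_mem hy]
          exact prob_le_one.trans le_self_add
        · exact (hsec y fun h => hy (subset_toMeasurable P H h)).trans le_add_self
    _ = P H + b := by
        rw [lintegral_add_right _ measurable_const,
          lintegral_indicator_one (measurableSet_toMeasurable P H), measure_toMeasurable]
        simp
    _ ≤ a + b := by gcongr

end Transfer

end TanhSpectral

end

/-! ### Choice of constants and the two probability bounds -/

theorem mainTheorem2 (α β δ : ℝ) (hα : 0 < α) (hβ : 0 ≤ β) (hδ : 0 < δ) :
    ∃ c c₀ : ℝ, 0 < c ∧ 0 < c₀ ∧ ∀ n m : ℕ, c₀ * (n : ℝ) < (m : ℝ) →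
      -- the estimate built from the leading eigenvector
      (∀ x : EuclideanSpace ℝ (Fin n), x ≠ 0 →
        ∀ (Ω : Type*) [MeasurableSpace Ω] (μ : Measure Ω) [IsProbabilityMeasure μ]
          (a : Fin m → Ω → EuclideanSpace ℝ (Fin n)),
          (∀ i, HasLaw (a i) (stdGaussian (EuclideanSpace ℝ (Fin n))) μ) → iIndepFun a μ →
          1 - Real.exp (-c * (m : ℝ)) ≤
            μ.real {ω | ∀ v : EuclideanSpace ℝ (Fin n),
              TanhSpectral.IsLeadingEigenvector α β (fun i => a i ω)
                (TanhSpectral.intensity (fun i => a i ω) x) v →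
              TanhSpectral.signDist
                (TanhSpectral.rescale (TanhSpectral.intensity (fun i => a i ω) x) v) x
                ≤ δ * ‖x‖}) ∧
      -- the estimate computed by sufficiently many power iterations from a random start
      (∃ T₀ : ℕ, ∀ T : ℕ, T₀ ≤ T → ∀ x : EuclideanSpace ℝ (Fin n), x ≠ 0 →
        ∀ (Ω : Type*) [MeasurableSpace Ω] (μ : Measure Ω) [IsProbabilityMeasure μ]
          (a : Fin m → Ω → EuclideanSpace ℝ (Fin n)) (g : Ω → EuclideanSpace ℝ (Fin n)),
          (∀ i, HasLaw (a i) (stdGaussian (EuclideanSpace ℝ (Fin n))) μ) → iIndepFun a μ →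
          HasLaw g (stdGaussian (EuclideanSpace ℝ (Fin n))) μ →
          IndepFun g (fun ω i => a i ω) μ →
          1 - Real.exp (-c * (m : ℝ)) ≤
            μ.real {ω | TanhSpectral.signDist
              (TanhSpectral.rescale (TanhSpectral.intensity (fun i => a i ω) x)
                (TanhSpectral.powerIterate α β (fun i => a i ω)
                  (TanhSpectral.intensity (fun i => a i ω) x) (g ω) T)) x
              ≤ δ * ‖x‖}) := by
  open TanhSpectral in
  set p := profileMoment α β 1 0 with hp_def
  set r := profileMoment α β 1 1 with hr_def
  have hp : 0 ≤ p := profileMoment_nonneg hα zero_le_one 0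
  have hpr : p < r := profileMoment_gap hα hβ
  have hrp : 0 < r - p := sub_pos.2 hpr
  -- The first bound makes power iteration contract, the second gives accuracy `δ`.
  set η := min ((r - p) / 8) (δ ^ 2 * (r - p) / 24) with hη_def
  have hη0 : 0 < η := by positivity
  have hη8 : 8 * η ≤ r - p := by
    have : η ≤ (r - p) / 8 := min_le_left _ _
    linarith
  have hη24 : 24 * η ≤ δ ^ 2 * (r - p) := by
    have : η ≤ δ ^ 2 * (r - p) / 24 := min_le_right _ _
    linarith
  obtain ⟨c, c₀, τ, hc, hc₀, hτ0, hτ, hgood⟩ :=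
    exists_rate_not_wellSpread hα hβ hη0 (half_pos hδ)
  refine ⟨c, c₀, hc, hc₀, fun n m hnm => ?_⟩
  have hunit : ∀ x : EuclideanSpace ℝ (Fin n), x ≠ 0 →
      ‖‖x‖⁻¹ • x‖ = 1 ∧ x = ‖x‖ • ‖x‖⁻¹ • x := fun x hx => by
    have hx' : ‖x‖ ≠ 0 := norm_ne_zero_iff.2 hx
    rw [norm_smul, norm_inv, norm_norm, inv_mul_cancel₀ hx', smul_smul, mul_inv_cancel₀ hx',
      one_smul]
    exact ⟨rfl, rfl⟩
  have hbad : ∀ x : EuclideanSpace ℝ (Fin n), x ≠ 0 →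
      sampleLaw n m {a | ¬ WellSpread α β p r η τ x (‖x‖⁻¹ • x) a}
        ≤ ENNReal.ofReal (1 / 2 * Real.exp (-c * m)) := fun x hx => by
    rw [← ofReal_measureReal]
    exact ENNReal.ofReal_le_ofReal (hgood n m hnm x _ (hunit x hx).2 hx (hunit x hx).1)
  have hexp : 0 < Real.exp (-c * m) := Real.exp_pos _
  constructor
  · intro x hx Ω _ μ _ a ha hind
    refine one_sub_le_measureReal (hasLaw_sample ha hind) (fun ω hω => ?_) hexp.le
      ((hbad x hx).trans (ENNReal.ofReal_le_ofReal (by linarith)))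
    exact fun h => hω fun v hv =>
      h.signDist_leading_le hpr (hunit x hx).1 (hunit x hx).2 hτ0.le hτ hη0.le hη24 hv
  -- The overlap `ε` is chosen before `x` and the sample, and is uniform over directions; hence `T₀`
  -- does not depend on `x`.
  · obtain ⟨ε, hε, hover⟩ := exists_overlap (EuclideanSpace ℝ (Fin n))
      (κ := 1 / 2 * Real.exp (-c * m)) (by positivity)
    have hrη : 0 < r - η := by linarith
    set ρ := (p + 3 * η) / (r - η) with hρ_def
    have hρ0 : 0 ≤ ρ := by positivity
    have hρ1 : ρ < 1 := by
      rw [hρ_def, div_lt_one hrη]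
      linarith
    have hlim : Filter.Tendsto (fun T : ℕ => (ρ ^ T / ε) ^ 2 * r) Filter.atTop (nhds 0) := by
      have := (((tendsto_pow_atTop_nhds_zero_of_lt_one hρ0 hρ1).div_const ε).pow 2).mul_const r
      simpa using this
    obtain ⟨T₀, hT₀⟩ := Filter.eventually_atTop.1 (hlim.eventually_le_const hη0)
    refine ⟨T₀, fun T hT x hx Ω _ μ _ a g ha hind hg hindg => ?_⟩
    have hm : m ≠ 0 := by
      rintro rfl
      have : 0 ≤ c₀ * (n : ℝ) := by positivity
      simp only [Nat.cast_zero] at hnm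
      linarith
    let S : Set (EuclideanSpace ℝ (Fin n) × (Fin m → EuclideanSpace ℝ (Fin n))) :=
      {q | ¬ signDist (rescale (intensity q.2 x)
        (powerIterate α β q.2 (intensity q.2 x) q.1 T)) x ≤ δ * ‖x‖}
    have hS : MeasurableSet S :=
      (measurableSet_le (measurable_signDist_powerIterate x T) measurable_const).compl
    refine one_sub_le_measureReal (hasLaw_start_sample (hasLaw_sample ha hind) hg hindg)
      (B := S) (fun ω hω => hω) hexp.le ?_
    -- The failure probability has two halves: the sample is not well spread, or, for a fixed
    -- well-spread sample, the independent start has too little overlap with its leading direction.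
    refine (prod_measure_le_of_sections hS (hbad x hx)
      (b := ENNReal.ofReal (1 / 2 * Real.exp (-c * m))) fun b hb => ?_).trans (le_of_eq ?_)
    · obtain ⟨v, hv, hvg⟩ := (not_not.1 hb : WellSpread α β p r η τ x (‖x‖⁻¹ • x) b).exists_direction
        hα hm hp hpr (hunit x hx).1 (hunit x hx).2 hτ0.le hτ hη0 hη8 hη24 hρ0
        (div_mul_cancel₀ _ hrη.ne').ge hε (hT₀ T hT)
      refine (measure_mono ?_).trans (hover v hv)
      exact fun g hg h => hg (hvg g h.1 h.2)
    · rw [← ENNReal.ofReal_add (by positivity) (by positivity)]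
      congr 1
      ring
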